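/- Let $\Omega\subset\mathbb R^d$, $d\in\{1,2,3\}$, be a bounded convex polyhedral domain (the non-empty interior of the convex hull of finitely many points), and let $\lambda_j$, $\varphi_j$ ($j\ge 1$) be the eigenvalues and $L^2(\Omega)$-orthonormal eigenfunctions $\varphi_j\in H^1_0(\Omega)$ of the Dirichlet Laplacian $-\Delta$ on $\Omega$. For $s\ge -1$ let $\dot H^s(\Omega)$ be the space of all $v\in H^{-1}(\Omega)=H^1_0(\Omega)'$ with $$\|v\|_{\dot H^s(\Omega)}^2=\sum_{j=1}^\infty\lambda_j^s\langle v,\varphi_j\rangle^2<\infty ,\qquad \|u\|_{L^2(0,t;\dot H^s(\Omega))}^2=\int_0^t\|u(\tau)\|_{\dot H^s(\Omega)}^2\,d\tau .$$ Let $T>0$, $m\ge 0$, $0<\alpha_i<\alpha<1$ and $b_i>0$ for $i=1,\dots,m$, and put $P(\partial_t)=\partial_t^\alpha+\sum_{i=1}^m b_i\,\partial_t^{\alpha_i}$. Here $\partial_t^\beta$, $0<\beta<1$, is the Caputo derivative of a function with zero initial data, in the weak sense: $\partial_t^\beta u=g$ on $(0,T)$ means that $u,g\in L^1(0,T;H^{-1}(\Omega))$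 and $$\frac1{\Gamma(1-\beta)}\int_0^t(t-\tau)^{-\beta}u(\tau)\,d\tau=\int_0^t g(\tau)\,d\tau\quad\text{for a.e. }t\in(0,T)$$ (for $u$ absolutely continuous with $u(0)=0$ this is $g(t)=\frac1{\Gamma(1-\beta)}\int_0^t(t-\tau)^{-\beta}u'(\tau)\,d\tau$). For $t>0$ and $\chi\in H^{-1}(\Omega)$ let $$\bar E(t)\chi=\sum_{j=1}^\infty t^{\alpha-1}E_{(\alpha,\alpha-\alpha_1,\dots,\alpha-\alpha_m),\alpha}\bigl(-\lambda_jt^\alpha,-b_1t^{\alpha-\alpha_1},\dots,-b_mt^{\alpha-\alpha_m}\bigr)\langle\chi,\varphi_j\rangle\varphi_j ,$$ where $$E_{(\beta_1,\dots,\beta_n),\beta}(z_1,\dots,z_n)=\sum_{k=0}^\infty\ \sum_{l_1+\dots+l_n=k}\frac{k!}{l_1!\cdots l_n!}\,\frac{\prod_{i=1}^n z_i^{l_i}}{\Gamma\bigl(\beta+\sum_{i=1}^n\beta_il_i\bigr)}$$ is the multinomial Mittag-Leffler function. Let $-1<q\le 1$. There is a constant $C$, which may depend on the data above but not on $f$ or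 $t$, such that for every $f\in L^2(0,T;\dot H^q(\Omega))$ the following holds. The function $$u(t)=\int_0^t\bar E(t-s)f(s)\,ds$$ is well defined for a.e. $t\in(0,T)$ (the series for $\bar E(t-s)f(s)$ converges in $H^{-1}(\Omega)$ for a.e. $s\in(0,t)$ and the integral converges as a Bochner integral in $H^{-1}(\Omega)$), $u\in L^2(0,T;\dot H^{q+2}(\Omega))$, $P(\partial_t)u$ exists on $(0,T)$ and belongs to $L^2(0,T;\dot H^q(\Omega))$, and for all $t\in(0,T]$ $$\|u\|_{L^2(0,t;\dot H^{q+2}(\Omega))}+\|P(\partial_t)u\|_{L^2(0,t;\dot H^q(\Omega))}\le C\,\|f\|_{L^2(0,t;\dot H^q(\Omega))} .$$ -/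

import Mathlib

open MeasureTheory Set
open scoped ENNReal NNReal ContDiff

namespace FracDiffusion

noncomputable section

/-- `Ω` is a bounded convex polygonal (polyhedral) domain: the non-empty interior of the convex
hull of finitely many points. -/
def IsConvexPolytopeDomain {d : ℕ} (Ω : Set (EuclideanSpace ℝ (Fin d))) : Prop :=
  Ω.Nonempty ∧
    ∃ S : Finset (EuclideanSpace ℝ (Fin d)), Ω = interior (convexHull ℝ (S : Set _))

/-- `L²(Ω)`, real valued. -/
abbrev L2 {d : ℕ} (Ω : Set (EuclideanSpace ℝ (Fin d))) : Type :=
  Lp ℝ 2 (volume.restrict Ω)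

/-- `L²(Ω; ℝᵈ)`. -/
abbrev L2Vec {d : ℕ} (Ω : Set (EuclideanSpace ℝ (Fin d))) : Type :=
  Lp (EuclideanSpace ℝ (Fin d)) 2 (volume.restrict Ω)

/-- The closure of `C_c^∞(Ω)` in the `H¹` norm. An element is stored as the pair `(w, ∇w)` in
`L²(Ω) × L²(Ω; ℝᵈ)`. -/
def H10Sub {d : ℕ} (Ω : Set (EuclideanSpace ℝ (Fin d))) :
    Submodule ℝ (WithLp 2 (L2 Ω × L2Vec Ω)) :=
  (Submodule.span ℝ {p : WithLp 2 (L2 Ω × L2Vec Ω) |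
    ∃ ψ : EuclideanSpace ℝ (Fin d) → ℝ,
      ContDiff ℝ ∞ ψ ∧ HasCompactSupport ψ ∧ tsupport ψ ⊆ Ω ∧
      p.fst =ᵐ[volume.restrict Ω] ψ ∧
      p.snd =ᵐ[volume.restrict Ω] gradient ψ}).topologicalClosure

/-- `H¹₀(Ω)` with the `H¹` inner product `(v, w)_{L²} + (∇v, ∇w)_{L²}`. -/
def H10 {d : ℕ} (Ω : Set (EuclideanSpace ℝ (Fin d))) : Type := H10Sub Ω

instance {d : ℕ} (Ω : Set (EuclideanSpace ℝ (Fin d))) : NormedAddCommGroup (H10 Ω) :=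
  inferInstanceAs (NormedAddCommGroup (H10Sub Ω))

instance {d : ℕ} (Ω : Set (EuclideanSpace ℝ (Fin d))) : InnerProductSpace ℝ (H10 Ω) :=
  inferInstanceAs (InnerProductSpace ℝ (H10Sub Ω))

/-- The inclusion of `H¹₀(Ω)` in `L²(Ω) × L²(Ω; ℝᵈ)`, `w ↦ (w, ∇w)`. -/
def H10.incl {d : ℕ} (Ω : Set (EuclideanSpace ℝ (Fin d))) :
    H10 Ω →L[ℝ] WithLp 2 (L2 Ω × L2Vec Ω) :=
  (H10Sub Ω).subtypeₗᵢ.toContinuousLinearMap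

/-- The `L²(Ω)` function underlying an element of `H¹₀(Ω)`. -/
def H10.val {d : ℕ} {Ω : Set (EuclideanSpace ℝ (Fin d))} (w : H10 Ω) : L2 Ω :=
  (H10.incl Ω w).fst

/-- The weak gradient of an element of `H¹₀(Ω)`. -/
def H10.grad {d : ℕ} {Ω : Set (EuclideanSpace ℝ (Fin d))} (w : H10 Ω) : L2Vec Ω :=
  (H10.incl Ω w).snd

/-- `H⁻¹(Ω)`, the dual of `H¹₀(Ω)`. -/
abbrev Hneg1 {d : ℕ} (Ω : Set (EuclideanSpace ℝ (Fin d))) : Type :=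
  StrongDual ℝ (H10 Ω)

/-- The embedding `L²(Ω) ⊂ H⁻¹(Ω)`, `g ↦ (w ↦ (g, w)_{L²})`. -/
def ofL2 {d : ℕ} {Ω : Set (EuclideanSpace ℝ (Fin d))} (g : L2 Ω) : Hneg1 Ω :=
  (innerSL ℝ g).comp ((WithLp.fstL 2 ℝ (L2 Ω) (L2Vec Ω)).comp (H10.incl Ω))

/-- `w ∈ H¹₀(Ω)` solves `-Δ w = μ w` weakly with homogeneous Dirichlet condition. -/
def IsDirichletEigen {d : ℕ} {Ω : Set (EuclideanSpace ℝ (Fin d))} (μ : ℝ) (w : H10 Ω) : Prop :=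
  ∀ v : H10 Ω, inner ℝ w.grad v.grad = μ * inner ℝ w.val v.val

/-- `(lam j, φ j)` are the eigenvalues and `L²(Ω)`-orthonormal eigenfunctions of the Dirichlet
Laplacian `-Δ`, with none left out: an eigenfunction that is `L²`-orthogonal to all the `φ j`
vanishes. -/
structure IsDirichletEigensystem {d : ℕ} (Ω : Set (EuclideanSpace ℝ (Fin d)))
    (lam : ℕ → ℝ) (φ : ℕ → H10 Ω) : Prop where
  eigen : ∀ j, IsDirichletEigen (lam j) (φ j)
  orthonormal : Orthonormal ℝ (fun j => (φ j).val)
  exhaustive : ∀ (μ : ℝ) (w : H10 Ω), IsDirichletEigen μ w →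
    (∀ j, inner ℝ w.val (φ j).val = 0) → w = 0

/-- The squared norm `‖v‖²_{Ḣˢ(Ω)} = ∑ⱼ λⱼˢ ⟨v, φⱼ⟩²` of `v ∈ H⁻¹(Ω)`; it is `∞` exactly when
`v ∉ Ḣˢ(Ω)`. -/
def dotHSq {d : ℕ} {Ω : Set (EuclideanSpace ℝ (Fin d))} (lam : ℕ → ℝ) (φ : ℕ → H10 Ω)
    (s : ℝ) (v : Hneg1 Ω) : ℝ≥0∞ :=
  ∑' j, ENNReal.ofReal (lam j ^ s * v (φ j) ^ 2)

/-- The norm `‖u‖_{L²(0,t;Ḣˢ(Ω))}`, with value in `[0,∞]`. -/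
def normL2DotH {d : ℕ} {Ω : Set (EuclideanSpace ℝ (Fin d))} (lam : ℕ → ℝ) (φ : ℕ → H10 Ω)
    (s t : ℝ) (u : ℝ → Hneg1 Ω) : ℝ≥0∞ :=
  (∫⁻ τ in Ioo 0 t, dotHSq lam φ s (u τ)) ^ (1 / 2 : ℝ)

/-- `u ∈ L²(0,T;Ḣˢ(Ω))`. -/
def MemL2DotH {d : ℕ} {Ω : Set (EuclideanSpace ℝ (Fin d))} (lam : ℕ → ℝ) (φ : ℕ → H10 Ω)
    (s T : ℝ) (u : ℝ → Hneg1 Ω) : Prop :=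
  AEStronglyMeasurable u (volume.restrict (Ioo 0 T)) ∧ normL2DotH lam φ s T u < ⊤

/-- The multinomial Mittag-Leffler function `E_{(β₁,…,βₙ),β}(z₁,…,zₙ)`. -/
def multiML {n : ℕ} (βs : Fin n → ℝ) (β : ℝ) (z : Fin n → ℝ) : ℝ :=
  ∑' k : ℕ, ∑ l ∈ Finset.piAntidiag (Finset.univ : Finset (Fin n)) k,
    (Nat.multinomial Finset.univ l : ℝ) * (∏ i, z i ^ l i) / Real.Gamma (β + ∑ i, βs i * l i)

/-- The scalar kernel
`t^{α-1} E_{(α,α-α₁,…,α-αₘ),α}(-μ t^α, -b₁ t^{α-α₁}, …, -bₘ t^{α-αₘ})`. -/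
def kernelE {m : ℕ} (α : ℝ) (a b : Fin m → ℝ) (μ t : ℝ) : ℝ :=
  t ^ (α - 1) * multiML (Fin.cons α fun i => α - a i : Fin (m + 1) → ℝ) α
    (Fin.cons (-μ * t ^ α) fun i => -b i * t ^ (α - a i) : Fin (m + 1) → ℝ)

/-- The `j`-th term of the series that defines `Ē(t) χ`. -/
def EbarTerm {d m : ℕ} {Ω : Set (EuclideanSpace ℝ (Fin d))} (lam : ℕ → ℝ) (φ : ℕ → H10 Ω)
    (α : ℝ) (a b : Fin m → ℝ) (t : ℝ) (χ : Hneg1 Ω) (j : ℕ) : Hneg1 Ω :=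
  (kernelE α a b (lam j) t * χ (φ j)) • ofL2 (φ j).val

/-- The operator `Ē(t) χ`, the sum of its series in `H⁻¹(Ω)`. -/
def Ebar {d m : ℕ} {Ω : Set (EuclideanSpace ℝ (Fin d))} (lam : ℕ → ℝ) (φ : ℕ → H10 Ω)
    (α : ℝ) (a b : Fin m → ℝ) (t : ℝ) (χ : Hneg1 Ω) : Hneg1 Ω :=
  ∑' j, EbarTerm lam φ α a b t χ j

/-- The solution representation with zero initial data, `u(t) = ∫₀ᵗ Ē(t-s) f(s) ds`
(a Bochner integral in `H⁻¹(Ω)`). -/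
def solRep {d m : ℕ} {Ω : Set (EuclideanSpace ℝ (Fin d))} (lam : ℕ → ℝ) (φ : ℕ → H10 Ω)
    (α : ℝ) (a b : Fin m → ℝ) (f : ℝ → Hneg1 Ω) (t : ℝ) : Hneg1 Ω :=
  ∫ s in Ioo 0 t, Ebar lam φ α a b (t - s) (f s)

/-- `g` is the (weak) Caputo derivative of order `β ∈ (0,1)` on `(0,T)` of a function `u` with zero
initial data: the fractional integral `Γ(1-β)⁻¹ ∫₀ᵗ (t-τ)^{-β} u(τ) dτ` is absolutely continuous,
vanishes at `0`, and has derivative `g`. If `u` is absolutely continuous with `u(0) = 0`, this `g`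
is `Γ(1-β)⁻¹ ∫₀ᵗ (t-τ)^{-β} u'(τ) dτ`. It determines `g` almost everywhere. -/
def HasCaputoDeriv {X : Type*} [NormedAddCommGroup X] [NormedSpace ℝ X]
    (β T : ℝ) (u g : ℝ → X) : Prop :=
  IntegrableOn u (Ioo 0 T) ∧ IntegrableOn g (Ioo 0 T) ∧
    ∀ᵐ t ∂(volume.restrict (Ioo 0 T)),
      IntegrableOn (fun τ => (t - τ) ^ (-β) • u τ) (Ioo 0 t) ∧
      (Real.Gamma (1 - β))⁻¹ • ∫ τ in Ioo 0 t, (t - τ) ^ (-β) • u τ = ∫ τ in Ioo 0 t, g τ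

/-- `g = P(∂ₜ) u` on `(0,T)`, where `P(∂ₜ) = ∂ₜ^α + ∑ᵢ bᵢ ∂ₜ^{αᵢ}` and every term is the weak Caputo
derivative of a function with zero initial data. -/
def HasMultiTermDeriv {X : Type*} [NormedAddCommGroup X] [NormedSpace ℝ X] {m : ℕ}
    (α : ℝ) (a b : Fin m → ℝ) (T : ℝ) (u g : ℝ → X) : Prop :=
  ∃ (g₀ : ℝ → X) (gs : Fin m → ℝ → X),
    HasCaputoDeriv α T u g₀ ∧ (∀ i, HasCaputoDeriv (a i) T u (gs i)) ∧
    ∀ᵐ t ∂(volume.restrict (Ioo 0 T)), g t = g₀ t + ∑ i, b i • gs i t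

end

end FracDiffusion

open FracDiffusion

namespace FracDiffusion

noncomputable section

/-! The equation decouples in the eigenbasis. With K_μ the scalar kernel for the eigenvalue μ, whose
Laplace transform is 1/(z^α + ∑ bᵢ z^{αᵢ} + μ), the coefficients are u_j = K_{λ_j} * f_j. Everything
rests on two facts about K_μ for μ ≥ 0: it is positive (`mlKer_pos`), and μ ∫₀ᵗ K_μ ≤ 1 for every t
(`mul_setIntegral_multiKer_le`). Young's inequality then gives ‖λ_j u_j‖ ≤ ‖f_j‖ in L²(0,t),
uniformly in j and t. Weighting the squares by λ_j^q and summing yields the bound on u. Formally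
P(∂ₜ)u has the coefficients f_j − λ_j u_j, so its norm is at most 2‖f‖, and the constant is 3.

The kernel calculus replaces Laplace transforms by the family `mlKer β w x`, with transform
z^{-x}/(1 − ∑ wᵢ z^{-βᵢ}). Two rules suffice: the recursion `mlKer_eq_add` and the semigroup law
`vconv_fracKer_mlKer`, by which fractional integration of order y raises x by y. Together they give
a Volterra equation, from which positivity follows by a first-zero argument, and the resolvent
identity K_0 − K_μ = μ K_0 * K_μ.

The resolvent identity is used twice. It shows K_μ ≤ K_0, so one integrable kernel dominates all
modes and the series and Bochner integral converge. It also gives K_μ * f_j = K_0 * (f_j − μ K_μ *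
f_j), so that u = K_0 * G with G = ∑ (f_j − λ_j u_j) φ_j. Since K_0 has transform 1/P(z),
convolution with it inverts P(∂ₜ) (`hasMultiTermDeriv_vconv`), and P(∂ₜ)u = G exists in the weak
sense.

In H⁻¹ the rescaled eigenfunctions turn series into orthonormal series. The Poincaré inequality
bounds the λ_j away from 0, which together with q > −1 embeds square-summable Ḣ^q data in H⁻¹.
Vector identities are verified coefficient by coefficient, because both sides factor through the
projection onto the closed span of the eigenfunctions. -/

/-! ### The multinomial Mittag-Leffler kernels -/

/-- The fractional integration kernel `t^{x-1} / Γ(x)`. -/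
def fracKer (x t : ℝ) : ℝ := t ^ (x - 1) / Real.Gamma x

/-- The homogeneous parts of the series of `mlKer`. -/
def mlPartial {ι : Type*} [Fintype ι] (β w : ι → ℝ) : ℕ → ℝ → ℝ → ℝ
  | 0, x, t => fracKer x t
  | k + 1, x, t => ∑ i, w i * mlPartial β w k (x + β i) t

/-- The kernel with Laplace transform `z^{-x} / (1 - ∑ᵢ wᵢ z^{-βᵢ})`. -/
def mlKer {ι : Type*} [Fintype ι] (β w : ι → ℝ) (x t : ℝ) : ℝ :=
  ∑' k, mlPartial β w k x t

/-- By the multinomial theorem both sides are values of a linear functional on powers of ∑ wᵢ X^{βᵢ}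
in the monoid algebra ℝ[ℝ], where X^y is sent to F(x + y). Multiplying by X^y shifts x by y, so
peeling one factor off the power gives the recursion that defines `mlPartial`. -/
theorem sum_piAntidiag_multinomial_succ {ι : Type*} [Fintype ι] [DecidableEq ι] (β w : ι → ℝ)
    (F : ℝ → ℝ) (k : ℕ) (x : ℝ) :
    ∑ l ∈ Finset.piAntidiag (Finset.univ : Finset ι) (k + 1),
      (Nat.multinomial Finset.univ l : ℝ) * (∏ i, w i ^ l i) * F (x + ∑ i, β i * l i) =
    ∑ j, w j * ∑ l ∈ Finset.piAntidiag (Finset.univ : Finset ι) k,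
      (Nat.multinomial Finset.univ l : ℝ) * (∏ i, w i ^ l i) *
        F (x + β j + ∑ i, β i * l i) := by
  let L : ℝ → AddMonoidAlgebra ℝ ℝ → ℝ := fun x p =>
    Finsupp.linearCombination ℝ (fun y => F (x + y)) p.coeff
  have hadd : ∀ x p p', L x (p + p') = L x p + L x p' := by
    intro x p p'; simp [L]
  have hzero : ∀ x, L x 0 = 0 := by intro x; simp [L]
  have hsum : ∀ {κ : Type _} (s : Finset κ) (f : κ → AddMonoidAlgebra ℝ ℝ) (x : ℝ),
      L x (∑ i ∈ s, f i) = ∑ i ∈ s, L x (f i) := by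
    intro κ s f x
    classical
    induction s using Finset.induction_on with
    | empty => simp [hzero]
    | insert a s ha ih => rw [Finset.sum_insert ha, Finset.sum_insert ha, hadd, ih]
  have hsingle : ∀ x y c, L x (AddMonoidAlgebra.single y c) = c * F (x + y) := by
    intro x y c; simp [L]
  have hmul : ∀ x y c p, L x (AddMonoidAlgebra.single y c * p) = c * L (x + y) p := by
    intro x y c p
    induction p using AddMonoidAlgebra.induction_linear with
    | zero => simp [hzero]
    | add p p' h h' => rw [mul_add, hadd, h, h', hadd]; ring
    | single z e => rw [AddMonoidAlgebra.single_mul_single, hsingle, hsingle, add_assoc]; ring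
  have hpow : ∀ k x, L x ((∑ i, AddMonoidAlgebra.single (β i) (w i)) ^ k) =
      ∑ l ∈ Finset.piAntidiag (Finset.univ : Finset ι) k,
      (Nat.multinomial Finset.univ l : ℝ) * (∏ i, w i ^ l i) * F (x + ∑ i, β i * l i) := by
    intro k x
    rw [Finset.sum_pow_eq_sum_piAntidiag, hsum]
    refine Finset.sum_congr rfl fun l _ => ?_
    have h1 : ∏ i, (AddMonoidAlgebra.single (β i) (w i) : AddMonoidAlgebra ℝ ℝ) ^ l i =
        AddMonoidAlgebra.single (∑ i, β i * l i) (∏ i, w i ^ l i) := by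
      simp_rw [AddMonoidAlgebra.single_pow]
      classical
      induction (Finset.univ : Finset ι) using Finset.induction_on with
      | empty => simp [AddMonoidAlgebra.one_def]
      | insert a s ha ih =>
        rw [Finset.prod_insert ha, Finset.sum_insert ha, Finset.prod_insert ha, ih,
          AddMonoidAlgebra.single_mul_single]
        simp [mul_comm]
    rw [h1]
    have h2 : ((Nat.multinomial Finset.univ l : ℕ) : AddMonoidAlgebra ℝ ℝ) =
        AddMonoidAlgebra.single 0 (Nat.multinomial Finset.univ l : ℝ) := by
      simp [AddMonoidAlgebra.natCast_def]
    rw [h2, hmul, hsingle, add_zero]; ring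
  rw [← hpow, pow_succ', Finset.sum_mul, hsum]
  refine Finset.sum_congr rfl fun j _ => ?_
  rw [hmul, hpow]

theorem mlPartial_eq_sum {ι : Type*} [Fintype ι] [DecidableEq ι] (β w : ι → ℝ) (k : ℕ)
    (x t : ℝ) : mlPartial β w k x t =
      ∑ l ∈ Finset.piAntidiag (Finset.univ : Finset ι) k,
      (Nat.multinomial Finset.univ l : ℝ) * (∏ i, w i ^ l i) *
        fracKer (x + ∑ i, β i * l i) t := by
  induction k generalizing x with
  | zero => simp [mlPartial, Nat.multinomial]
  | succ k ih =>
    rw [sum_piAntidiag_multinomial_succ β w (fun y => fracKer y t)]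
    simp only [mlPartial, ih]

theorem rpow_mul_multiML {n : ℕ} (β w : Fin n → ℝ) (x : ℝ) {t : ℝ} (ht : 0 < t) :
    t ^ (x - 1) * multiML β x (fun i => w i * t ^ β i) = mlKer β w x t := by
  rw [multiML, mlKer, ← tsum_mul_left]
  refine tsum_congr fun k => ?_
  rw [mlPartial_eq_sum, Finset.mul_sum]
  refine Finset.sum_congr rfl fun l _ => ?_
  have h1 : ∏ i, (w i * t ^ β i) ^ l i = (∏ i, w i ^ l i) * t ^ (∑ i, β i * l i) := by
    simp_rw [mul_pow, Finset.prod_mul_distrib]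
    rw [Real.rpow_sum_of_pos ht]
    congr 1
    refine Finset.prod_congr rfl fun i _ => ?_
    rw [Real.rpow_mul ht.le, Real.rpow_natCast]
  rw [h1, fracKer, show x + ∑ i, β i * (l i : ℝ) - 1 = (x - 1) + ∑ i, β i * (l i : ℝ) by ring,
    Real.rpow_add ht]
  ring

/-- The exponents of the multi-term kernel. -/
def multiExp {m : ℕ} (α : ℝ) (a : Fin m → ℝ) : Fin (m + 1) → ℝ :=
  Fin.cons α fun i => α - a i

/-- The coefficients of the multi-term kernel. -/
def multiCoef {m : ℕ} (b : Fin m → ℝ) (μ : ℝ) : Fin (m + 1) → ℝ :=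
  Fin.cons (-μ) fun i => -b i

theorem kernelE_eq_mlKer {m : ℕ} (α : ℝ) (a b : Fin m → ℝ) (μ : ℝ) {t : ℝ} (ht : 0 < t) :
    kernelE α a b μ t = mlKer (multiExp α a) (multiCoef b μ) α t := by
  rw [← rpow_mul_multiML _ _ _ ht, kernelE]
  congr 2
  funext i
  refine Fin.cases ?_ (fun i => ?_) i <;> simp [multiExp, multiCoef]

/-! ### Bounds for the kernels -/

/-- Euler's integral is cut down to (A, ∞), where y^{x-1} ≥ A^{x-1}. The free parameter A makes 1/Γ
decay at any prescribed geometric rate, which is all the growth information the series needs. -/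
theorem exp_neg_mul_rpow_le_Gamma_of_one_le {A x : ℝ} (hA : 0 < A) (hx : 1 ≤ x) :
    Real.exp (-A) * A ^ (x - 1) ≤ Real.Gamma x := by
  rw [Real.Gamma_eq_integral (by linarith)]
  have hconv := Real.GammaIntegral_convergent (s := x) (by linarith)
  have h1 : ∫ y in Ioi A, Real.exp (-y) * A ^ (x - 1) = Real.exp (-A) * A ^ (x - 1) := by
    rw [integral_mul_const, integral_exp_neg_Ioi]
  rw [← h1]
  calc ∫ y in Ioi A, Real.exp (-y) * A ^ (x - 1)
      ≤ ∫ y in Ioi A, Real.exp (-y) * y ^ (x - 1) := by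
        refine setIntegral_mono_on ?_ (hconv.mono_set (Ioi_subset_Ioi hA.le)) measurableSet_Ioi ?_
        · have h := exp_neg_integrableOn_Ioi A one_pos
          simp only [neg_one_mul] at h
          exact h.mul_const _
        · intro y hy
          have : A ≤ y := le_of_lt hy
          gcongr
    _ ≤ ∫ y in Ioi 0, Real.exp (-y) * y ^ (x - 1) := by
        refine setIntegral_mono_set hconv ?_ (Ioi_subset_Ioi hA.le).eventuallyLE
        filter_upwards [self_mem_ae_restrict measurableSet_Ioi] with y hy
        have : (0 : ℝ) < y := hy
        positivity

theorem exp_neg_mul_rpow_le_Gamma {A x : ℝ} (hA : 1 ≤ A) (hx : 0 < x) :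
    Real.exp (-A) * A ^ (x - 1) ≤ Real.Gamma x := by
  rcases le_or_gt 1 x with h | h
  · exact exp_neg_mul_rpow_le_Gamma_of_one_le (by linarith) h
  · have h1 := exp_neg_mul_rpow_le_Gamma_of_one_le (A := A) (x := x + 1) (by linarith)
      (by linarith)
    rw [Real.Gamma_add_one hx.ne'] at h1
    have hG := Real.Gamma_pos_of_pos hx
    have h2 : A ^ (x - 1) ≤ A ^ (x + 1 - 1) :=
      Real.rpow_le_rpow_of_exponent_le hA (by linarith)
    have h3 := Real.exp_pos (-A)
    nlinarith

theorem fracKer_nonneg {x t : ℝ} (hx : 0 < x) (ht : 0 ≤ t) : 0 ≤ fracKer x t :=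
  div_nonneg (Real.rpow_nonneg ht _) (Real.Gamma_pos_of_pos hx).le

theorem fracKer_one (t : ℝ) : fracKer 1 t = 1 := by simp [fracKer]

theorem fracKer_le {A x t : ℝ} (hA : 1 ≤ A) (hx : 0 < x) (ht : 0 < t) :
    fracKer x t ≤ Real.exp A * (t / A) ^ (x - 1) := by
  have hA0 : 0 < A := by linarith
  have h := exp_neg_mul_rpow_le_Gamma hA hx
  have hG := Real.Gamma_pos_of_pos hx
  rw [fracKer, div_le_iff₀ hG, Real.div_rpow ht.le hA0.le]
  have h1 : 0 < A ^ (x - 1) := Real.rpow_pos_of_pos hA0 _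
  have h2 : 0 < t ^ (x - 1) := Real.rpow_pos_of_pos ht _
  calc t ^ (x - 1)
      = Real.exp A * (t ^ (x - 1) / A ^ (x - 1)) * (Real.exp (-A) * A ^ (x - 1)) := by
        rw [Real.exp_neg]; field_simp
    _ ≤ _ := by gcongr

section Kernel

variable {ι : Type*} [Fintype ι] {β w : ι → ℝ}

theorem abs_mlPartial_le (hβ : ∀ i, 0 < β i) {A t : ℝ} (hA : 1 ≤ A) (ht : 0 < t) (k : ℕ)
    {x : ℝ} (hx : 0 < x) :
    |mlPartial β w k x t| ≤
      Real.exp A * (t / A) ^ (x - 1) * (∑ i, |w i| * (t / A) ^ β i) ^ k := by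
  have htA : 0 < t / A := by positivity
  induction k generalizing x with
  | zero =>
    rw [pow_zero, mul_one, mlPartial, abs_of_nonneg (fracKer_nonneg hx ht.le)]
    exact fracKer_le hA hx ht
  | succ k ih =>
    rw [mlPartial, pow_succ', Finset.sum_mul, Finset.mul_sum]
    refine (Finset.abs_sum_le_sum_abs _ _).trans (Finset.sum_le_sum fun i _ => ?_)
    rw [abs_mul]
    have h := ih (x := x + β i) (by have := hβ i; linarith)
    calc |w i| * |mlPartial β w k (x + β i) t| ≤ |w i| * _ :=
          mul_le_mul_of_nonneg_left h (abs_nonneg _)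
      _ = _ := by
        rw [show x + β i - 1 = (x - 1) + β i by ring, Real.rpow_add htA]; ring

/-- The exponents are positive, so a large A makes the sum small at t = T, and monotonicity covers
smaller t. With this A the series of `mlKer` is dominated by a geometric series uniformly on (0, T].
-/
theorem exists_contraction_scale (hβ : ∀ i, 0 < β i) (w : ι → ℝ) (T : ℝ) :
    ∃ A : ℝ, 1 ≤ A ∧ ∀ t, 0 < t → t ≤ T → ∑ i, |w i| * (t / A) ^ β i ≤ 1 / 2 := by
  have h1 : Filter.Tendsto (fun A : ℝ => ∑ i, |w i| * (T / A) ^ β i) Filter.atTop (nhds 0) := by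
    have : (0 : ℝ) = ∑ i, |w i| * 0 := by simp
    rw [this]
    refine tendsto_finsetSum _ fun i _ => Filter.Tendsto.const_mul _ ?_
    have h2 : Filter.Tendsto (fun A : ℝ => T / A) Filter.atTop (nhds 0) :=
      Filter.Tendsto.div_atTop tendsto_const_nhds Filter.tendsto_id
    have h3 := h2.rpow_const (p := β i) (Or.inr (hβ i).le)
    rwa [Real.zero_rpow (hβ i).ne'] at h3
  obtain ⟨A, hA1, hA⟩ := ((Filter.eventually_ge_atTop (1 : ℝ)).and
    (h1.eventually (gt_mem_nhds (show (0 : ℝ) < 1 / 2 by norm_num)))).exists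
  refine ⟨A, hA1, fun t ht htT => le_trans ?_ hA.le⟩
  refine Finset.sum_le_sum fun i _ => mul_le_mul_of_nonneg_left ?_ (abs_nonneg _)
  have hA0 : 0 < A := by linarith
  exact Real.rpow_le_rpow (by positivity) (by gcongr) (hβ i).le

theorem exists_mlPartial_bound (hβ : ∀ i, 0 < β i) (w : ι → ℝ) (T : ℝ) {x : ℝ} (hx : 0 < x) :
    ∃ C : ℝ, 0 ≤ C ∧ ∀ k t, 0 < t → t ≤ T →
      |mlPartial β w k x t| ≤ C * t ^ (x - 1) * (1 / 2) ^ k := by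
  obtain ⟨A, hA1, hA⟩ := exists_contraction_scale hβ w T
  have hA0 : 0 < A := by linarith
  refine ⟨Real.exp A / A ^ (x - 1), by positivity, fun k t ht htT => ?_⟩
  refine (abs_mlPartial_le hβ hA1 ht k hx).trans ?_
  rw [Real.div_rpow ht.le hA0.le]
  have h0 : 0 ≤ ∑ i, |w i| * (t / A) ^ β i := by positivity
  have h1 := pow_le_pow_left₀ h0 (hA t ht htT) k
  have h2 : 0 ≤ t ^ (x - 1) := by positivity
  calc _ ≤ Real.exp A * (t ^ (x - 1) / A ^ (x - 1)) * (1 / 2) ^ k := by gcongr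
    _ = _ := by ring

theorem summable_mlPartial (hβ : ∀ i, 0 < β i) {x t : ℝ} (hx : 0 < x) (ht : 0 < t) :
    Summable fun k => mlPartial β w k x t := by
  obtain ⟨C, -, hC⟩ := exists_mlPartial_bound hβ w t hx
  refine Summable.of_norm_bounded
    (g := fun k : ℕ => C * t ^ (x - 1) * (1 / 2 : ℝ) ^ k) ?_ (fun k => hC k t ht le_rfl)
  exact (summable_geometric_of_lt_one (by norm_num) (by norm_num)).mul_left _

/-- In Laplace variables this is 1/(1 − σ) = 1 + σ/(1 − σ) with σ = ∑ wᵢ z^{-βᵢ}. -/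
theorem mlKer_eq_add (hβ : ∀ i, 0 < β i) {x t : ℝ} (hx : 0 < x) (ht : 0 < t) :
    mlKer β w x t = fracKer x t + ∑ i, w i * mlKer β w (x + β i) t := by
  rw [mlKer, (summable_mlPartial hβ hx ht).tsum_eq_zero_add]
  congr 1
  simp only [mlPartial, mlKer]
  rw [Summable.tsum_finsetSum]
  · exact Finset.sum_congr rfl fun i _ => tsum_mul_left
  · intro i _
    exact (summable_mlPartial hβ (by have := hβ i; linarith) ht).mul_left _

theorem exists_mlKer_bound (hβ : ∀ i, 0 < β i) (w : ι → ℝ) (T : ℝ) {x : ℝ} (hx : 0 < x) :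
    ∃ C : ℝ, 0 ≤ C ∧ ∀ t, 0 < t → t ≤ T → |mlKer β w x t| ≤ C * t ^ (x - 1) := by
  obtain ⟨C, hC0, hC⟩ := exists_mlPartial_bound hβ w T hx
  refine ⟨C * 2, by positivity, fun t ht htT => ?_⟩
  have hs : HasSum (fun k : ℕ => C * t ^ (x - 1) * (1 / 2 : ℝ) ^ k) (C * t ^ (x - 1) * 2) :=
    hasSum_geometric_two.mul_left _
  have := tsum_of_norm_bounded (f := fun k => mlPartial β w k x t) hs
    (fun k => hC k t ht htT)
  rw [Real.norm_eq_abs] at this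
  calc _ ≤ _ := this
    _ = _ := by ring

theorem continuousOn_fracKer (x : ℝ) : ContinuousOn (fracKer x) (Ioi 0) := by
  refine ContinuousOn.div_const ?_ _
  exact fun t ht => (Real.continuousAt_rpow_const t _ (Or.inl (ne_of_gt ht))).continuousWithinAt

theorem continuousOn_mlPartial (k : ℕ) (x : ℝ) :
    ContinuousOn (mlPartial β w k x) (Ioi 0) := by
  induction k generalizing x with
  | zero => exact continuousOn_fracKer x
  | succ k ih =>
    exact continuousOn_finsetSum _ fun i _ => continuousOn_const.mul (ih _)

theorem continuousOn_mlKer (hβ : ∀ i, 0 < β i) {x : ℝ} (hx : 0 < x) :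
    ContinuousOn (mlKer β w x) (Ioi 0) := by
  intro t ht
  have ht' : (0 : ℝ) < t := ht
  obtain ⟨C, hC0, hC⟩ := exists_mlPartial_bound hβ w (2 * t) hx
  -- The power is increasing or decreasing according to the sign of x − 1; the sum of both endpoint
  -- values bounds it in either case.
  let M := (t / 2) ^ (x - 1) + (2 * t) ^ (x - 1)
  have hcont : ContinuousOn (mlKer β w x) (Icc (t / 2) (2 * t)) := by
    refine continuousOn_tsum (u := fun k : ℕ => C * M * (1 / 2 : ℝ) ^ k)
      (fun k => (continuousOn_mlPartial k x).mono fun s hs => ?_) ?_ ?_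
    · exact lt_of_lt_of_le (by positivity) hs.1
    · exact (summable_geometric_of_lt_one (by norm_num) (by norm_num)).mul_left _
    · intro k s hs
      have hs0 : 0 < s := lt_of_lt_of_le (by positivity) hs.1
      refine (hC k s hs0 hs.2).trans ?_
      have h1 : s ^ (x - 1) ≤ M := by
        have p1 : 0 ≤ (t / 2) ^ (x - 1) := by positivity
        have p2 : 0 ≤ (2 * t) ^ (x - 1) := by positivity
        rcases le_total 1 x with h | h
        · have := Real.rpow_le_rpow hs0.le hs.2 (sub_nonneg.2 h)
          simp only [M]; linarith
        · have := Real.rpow_le_rpow_of_nonpos (by positivity) hs.1 (sub_nonpos.2 h)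
          simp only [M]; linarith
      gcongr
  exact (hcont.continuousAt (Icc_mem_nhds (by linarith) (by linarith))).continuousWithinAt

theorem integrableOn_rpow_Ioo {x : ℝ} (hx : 0 < x) (T : ℝ) :
    IntegrableOn (fun t : ℝ => t ^ (x - 1)) (Ioo 0 T) := by
  rcases le_or_gt T 0 with h | h
  · simp [Ioo_eq_empty (not_lt.2 h)]
  · have := (intervalIntegral.intervalIntegrable_rpow' (a := 0) (b := T)
      (show -1 < x - 1 by linarith))
    rw [intervalIntegrable_iff_integrableOn_Ioo_of_le h.le] at this
    exact this

theorem integrableOn_fracKer {x : ℝ} (hx : 0 < x) (T : ℝ) :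
    IntegrableOn (fracKer x) (Ioo 0 T) :=
  (integrableOn_rpow_Ioo hx T).div_const _

theorem integrableOn_mlKer (hβ : ∀ i, 0 < β i) {x : ℝ} (hx : 0 < x) (T : ℝ) :
    IntegrableOn (mlKer β w x) (Ioo 0 T) := by
  obtain ⟨C, hC0, hC⟩ := exists_mlKer_bound hβ w T hx
  refine Integrable.mono' ((integrableOn_rpow_Ioo hx T).const_mul C)
    (((continuousOn_mlKer hβ hx).mono Ioo_subset_Ioi_self).aestronglyMeasurable
      measurableSet_Ioo) ?_
  filter_upwards [self_mem_ae_restrict measurableSet_Ioo] with t ht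
  exact hC t ht.1 ht.2.le

end Kernel

/-! ### Convolution on a half line -/

section Conv

variable {X : Type*} [NormedAddCommGroup X] [NormedSpace ℝ X]

/-- The one-sided convolution `∫₀ᵗ k(t-s) v(s) ds`. -/
def vconv (k : ℝ → ℝ) (v : ℝ → X) (t : ℝ) : X := ∫ s in Ioo 0 t, k (t - s) • v s

theorem vconv_of_nonpos (k : ℝ → ℝ) (v : ℝ → X) {t : ℝ} (ht : t ≤ 0) : vconv k v t = 0 := by
  simp [vconv, Ioo_eq_empty (not_lt.2 ht)]

theorem indicator_vconv_integrand (k : ℝ → ℝ) (v : ℝ → X) {t T : ℝ} (ht : t ≤ T) :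
    (Ioo 0 t).indicator (fun s => k (t - s) • v s) =
      fun s => (Ioo 0 T).indicator k (t - s) • (Ioo 0 T).indicator v s := by
  funext s
  by_cases hs : s ∈ Ioo 0 t
  · rw [indicator_of_mem hs, indicator_of_mem, indicator_of_mem]
    · exact ⟨hs.1, hs.2.trans_le ht⟩
    · exact ⟨by linarith [hs.2], by linarith [hs.1]⟩
  · rw [indicator_of_notMem hs]
    by_cases h1 : s ∈ Ioo 0 T
    · rw [indicator_of_notMem (s := Ioo 0 T) (a := t - s), zero_smul]
      exact fun h2 => hs ⟨h1.1, by linarith [h2.1]⟩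
    · rw [indicator_of_notMem h1, smul_zero]

/-- Truncating both factors to (0, T) does not change the one-sided convolution up to time T.
Kernels integrable only on bounded intervals thus fall under the theory of convolution on ℝ. -/
theorem vconv_eq_convolution (k : ℝ → ℝ) (v : ℝ → X) {t T : ℝ} (ht : t ≤ T) :
    vconv k v t = convolution ((Ioo 0 T).indicator k) ((Ioo 0 T).indicator v)
      (ContinuousLinearMap.lsmul ℝ ℝ) volume t := by
  rw [convolution_eq_swap, vconv, ← integral_indicator measurableSet_Ioo,
    indicator_vconv_integrand k v ht]
  rfl

theorem integrableOn_vconv_integrand_iff (k : ℝ → ℝ) (v : ℝ → X) {t T : ℝ} (ht : t ≤ T) :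
    IntegrableOn (fun s => k (t - s) • v s) (Ioo 0 t) ↔
      ConvolutionExistsAt ((Ioo 0 T).indicator k) ((Ioo 0 T).indicator v) t
      (ContinuousLinearMap.lsmul ℝ ℝ) volume := by
  rw [convolutionExistsAt_iff_integrable_swap, ← integrable_indicator_iff measurableSet_Ioo,
    indicator_vconv_integrand k v ht]
  rfl

theorem ae_integrableOn_vconv {k : ℝ → ℝ} {v : ℝ → X} {T : ℝ} (hk : IntegrableOn k (Ioo 0 T))
    (hv : IntegrableOn v (Ioo 0 T)) :
    ∀ᵐ t ∂(volume.restrict (Ioo 0 T)), IntegrableOn (fun s => k (t - s) • v s) (Ioo 0 t) := by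
  rw [← integrable_indicator_iff measurableSet_Ioo] at hk hv
  filter_upwards [self_mem_ae_restrict measurableSet_Ioo,
    ae_restrict_of_ae (hk.ae_convolution_exists (ContinuousLinearMap.lsmul ℝ ℝ) hv)] with t ht h
  exact (integrableOn_vconv_integrand_iff k v ht.2.le).2 h

theorem integrableOn_vconv {k : ℝ → ℝ} {v : ℝ → X} {T : ℝ} (hk : IntegrableOn k (Ioo 0 T))
    (hv : IntegrableOn v (Ioo 0 T)) : IntegrableOn (vconv k v) (Ioo 0 T) := by
  rw [← integrable_indicator_iff measurableSet_Ioo] at hk hv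
  refine ((hk.integrable_convolution (ContinuousLinearMap.lsmul ℝ ℝ) hv).integrableOn).congr_fun
    (fun t ht => ?_) measurableSet_Ioo
  exact (vconv_eq_convolution k v ht.2.le).symm

/-- The restriction t < T matters: from T on the left side vanishes, while the convolution of the
truncated factors need not. -/
theorem indicator_vconv_eq_convolution (k : ℝ → ℝ) (v : ℝ → X) {t T : ℝ} (ht : t < T) :
    (Ioo 0 T).indicator (vconv k v) t =
      convolution ((Ioo 0 T).indicator k) ((Ioo 0 T).indicator v)
      (ContinuousLinearMap.lsmul ℝ ℝ) volume t := by
  rw [← vconv_eq_convolution k v ht.le]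
  rcases le_or_gt t 0 with h | h
  · rw [vconv_of_nonpos _ _ h, indicator_of_notMem (fun h' => absurd h'.1 (not_lt.2 h))]
  · rw [indicator_of_mem (show t ∈ Ioo 0 T from ⟨h, ht⟩)]

theorem vconv_congr {k k' : ℝ → ℝ} {v v' : ℝ → X} {T : ℝ}
    (hk : k =ᵐ[volume.restrict (Ioo 0 T)] k') (hv : v =ᵐ[volume.restrict (Ioo 0 T)] v')
    {t : ℝ} (ht : t ≤ T) : vconv k v t = vconv k' v' t := by
  rw [vconv_eq_convolution k v ht, vconv_eq_convolution k' v' ht, convolution_eq_swap,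
    convolution_eq_swap]
  have hk' := (ae_restrict_iff' measurableSet_Ioo).1 hk
  have hv' := (ae_restrict_iff' measurableSet_Ioo).1 hv
  refine integral_congr_ae ?_
  have h2 := (quasiMeasurePreserving_sub_left_of_right_invariant (volume : Measure ℝ) t).ae hk'
  filter_upwards [h2, hv'] with s h1 h2
  have e1 : (Ioo 0 T).indicator k (t - s) = (Ioo 0 T).indicator k' (t - s) := by
    by_cases h : t - s ∈ Ioo 0 T
    · rw [indicator_of_mem h, indicator_of_mem h, h1 h]
    · rw [indicator_of_notMem h, indicator_of_notMem h]
  have e2 : (Ioo 0 T).indicator v s = (Ioo 0 T).indicator v' s := by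
    by_cases h : s ∈ Ioo 0 T
    · rw [indicator_of_mem h, indicator_of_mem h, h2 h]
    · rw [indicator_of_notMem h, indicator_of_notMem h]
  rw [e1, e2]

theorem vconv_comm (k l : ℝ → ℝ) (t : ℝ) : vconv k l t = vconv l k t := by
  rw [vconv_eq_convolution k l le_rfl, vconv_eq_convolution l k le_rfl, convolution_eq_swap]
  simp only [convolution, ContinuousLinearMap.lsmul_apply, smul_eq_mul]
  exact integral_congr_ae (Filter.Eventually.of_forall fun s => mul_comm _ _)

theorem vconv_assoc [CompleteSpace X] {k l : ℝ → ℝ} {v : ℝ → X} {T : ℝ} (hk : IntegrableOn k (Ioo 0 T))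
    (hl : IntegrableOn l (Ioo 0 T)) (hv : IntegrableOn v (Ioo 0 T)) :
    ∀ᵐ t ∂(volume.restrict (Ioo 0 T)), vconv (vconv k l) v t = vconv k (vconv l v) t := by
  have hk' := (integrable_indicator_iff measurableSet_Ioo).2 hk
  have hl' := (integrable_indicator_iff measurableSet_Ioo).2 hl
  have hv' := (integrable_indicator_iff measurableSet_Ioo).2 hv
  have hlv := hl'.norm.integrable_convolution (ContinuousLinearMap.mul ℝ ℝ) hv'.norm
  filter_upwards [self_mem_ae_restrict measurableSet_Ioo, ae_restrict_of_ae
    (hk'.norm.ae_convolution_exists (ContinuousLinearMap.mul ℝ ℝ) hlv)] with t ht hex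
  have hassoc := convolution_assoc (ContinuousLinearMap.lsmul ℝ ℝ) (ContinuousLinearMap.lsmul ℝ ℝ)
    (ContinuousLinearMap.lsmul ℝ ℝ) (ContinuousLinearMap.lsmul ℝ ℝ)
    (fun (x y : ℝ) (z : X) => by
      simp only [ContinuousLinearMap.lsmul_apply, smul_eq_mul, mul_smul]) hk'.1 hl'.1 hv'.1
    (hk'.ae_convolution_exists _ hl')
    (hl'.norm.ae_convolution_exists (ContinuousLinearMap.mul ℝ ℝ) hv'.norm) hex
  rw [vconv_eq_convolution _ _ ht.2.le, vconv_eq_convolution _ _ ht.2.le]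
  convert hassoc using 1
  · rw [convolution_eq_swap, convolution_eq_swap]
    refine integral_congr_ae (Filter.Eventually.of_forall fun s => ?_)
    by_cases hs : s ∈ Ioo 0 T
    · simp only [ContinuousLinearMap.lsmul_apply]
      rw [indicator_vconv_eq_convolution k l (by linarith [hs.1, ht.2])]
    · simp [indicator_of_notMem hs]
  · rw [convolution_eq_swap, convolution_eq_swap]
    refine integral_congr_ae (Filter.Eventually.of_forall fun s => ?_)
    simp only [ContinuousLinearMap.lsmul_apply]
    by_cases hs : s < T
    · rw [indicator_vconv_eq_convolution l v hs]
    · rw [indicator_of_notMem (s := Ioo 0 T) (a := t - s), zero_smul, zero_smul]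
      exact fun h => absurd h.1 (by linarith [ht.2])

theorem vconv_smul_left (c : ℝ) (k : ℝ → ℝ) (v : ℝ → X) (t : ℝ) :
    vconv (fun s => c * k s) v t = c • vconv k v t := by
  simp only [vconv, mul_smul, integral_smul]

theorem vconv_smul_right (c : ℝ) (k : ℝ → ℝ) (v : ℝ → X) (t : ℝ) :
    vconv k (fun s => c • v s) t = c • vconv k v t := by
  simp only [vconv, smul_comm _ c, integral_smul]

theorem vconv_add_left {k l : ℝ → ℝ} {v : ℝ → X} {t : ℝ}
    (hk : IntegrableOn (fun s => k (t - s) • v s) (Ioo 0 t))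
    (hl : IntegrableOn (fun s => l (t - s) • v s) (Ioo 0 t)) :
    vconv (fun s => k s + l s) v t = vconv k v t + vconv l v t := by
  simp only [vconv, add_smul]
  exact integral_add hk hl

theorem vconv_sub_right {k : ℝ → ℝ} {v v' : ℝ → X} {t : ℝ}
    (hv : IntegrableOn (fun s => k (t - s) • v s) (Ioo 0 t))
    (hv' : IntegrableOn (fun s => k (t - s) • v' s) (Ioo 0 t)) :
    vconv k (fun s => v s - v' s) t = vconv k v t - vconv k v' t := by
  simp only [vconv, smul_sub]
  exact integral_sub hv hv'

theorem vconv_sum_left {ι : Type*} (I : Finset ι) (c : ι → ℝ) {k : ι → ℝ → ℝ} {v : ℝ → X} {t : ℝ}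
    (hk : ∀ i ∈ I, IntegrableOn (fun s => k i (t - s) • v s) (Ioo 0 t)) :
    vconv (fun s => ∑ i ∈ I, c i * k i s) v t = ∑ i ∈ I, c i • vconv (k i) v t := by
  simp only [vconv, Finset.sum_smul, mul_smul]
  rw [integral_finsetSum]
  · simp only [integral_smul]
  · exact fun i hi => (hk i hi).smul (c i)

theorem integrableOn_sum_left {ι : Type*} (I : Finset ι) (c : ι → ℝ) {k : ι → ℝ → ℝ} {v : ℝ → X}
    {t : ℝ} (hk : ∀ i ∈ I, IntegrableOn (fun s => k i (t - s) • v s) (Ioo 0 t)) :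
    IntegrableOn (fun s => (∑ i ∈ I, c i * k i (t - s)) • v s) (Ioo 0 t) := by
  simp only [Finset.sum_smul, mul_smul]
  exact integrable_finsetSum _ fun i hi => (hk i hi).smul (c i)

end Conv

/-! ### Semigroup property of the kernels -/

theorem setIntegral_beta {x y t : ℝ} (hx : 0 < x) (hy : 0 < y) (ht : 0 < t) :
    ∫ s in Ioo 0 t, (t - s) ^ (y - 1) * s ^ (x - 1) =
      t ^ (x + y - 1) * (Real.Gamma x * Real.Gamma y / Real.Gamma (x + y)) := by
  have h := Complex.betaIntegral_scaled (x : ℂ) (y : ℂ) ht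
  have hb := Complex.Gamma_mul_Gamma_eq_betaIntegral (s := x) (t := y) (by simpa) (by simpa)
  have hG : Complex.Gamma ((x : ℂ) + y) ≠ 0 := by
    rw [← Complex.ofReal_add, Complex.Gamma_ofReal]
    exact_mod_cast (Real.Gamma_pos_of_pos (add_pos hx hy)).ne'
  have hb' : Complex.betaIntegral x y =
      ((Real.Gamma x * Real.Gamma y / Real.Gamma (x + y) : ℝ) : ℂ) := by
    push_cast
    rw [← Complex.Gamma_ofReal, ← Complex.Gamma_ofReal, ← Complex.Gamma_ofReal,
      Complex.ofReal_add, hb]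
    field_simp
  rw [hb'] at h
  have h1 : ∫ s in (0 : ℝ)..t, (s : ℂ) ^ ((x : ℂ) - 1) * ((t : ℂ) - s) ^ ((y : ℂ) - 1) =
      ((∫ s in Ioo 0 t, (t - s) ^ (y - 1) * s ^ (x - 1) : ℝ) : ℂ) := by
    rw [intervalIntegral.integral_of_le ht.le, integral_Ioc_eq_integral_Ioo, ← integral_complex_ofReal]
    refine setIntegral_congr_fun measurableSet_Ioo fun s hs => ?_
    have e1 : (0 : ℝ) ≤ t - s := by linarith [hs.2]
    push_cast
    rw [Complex.ofReal_cpow hs.1.le, Complex.ofReal_cpow e1]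
    push_cast
    ring
  rw [h1] at h
  have h2 : ((t : ℂ) ^ ((x : ℂ) + y - 1)) = ((t ^ (x + y - 1) : ℝ) : ℂ) := by
    rw [Complex.ofReal_cpow ht.le]; push_cast; rfl
  rw [h2] at h
  exact_mod_cast h

theorem integrableOn_beta {x y t : ℝ} (hx : 0 < x) (hy : 0 < y) (ht : 0 < t) :
    IntegrableOn (fun s => (t - s) ^ (y - 1) * s ^ (x - 1)) (Ioo 0 t) := by
  -- A nonintegrable function has integral 0 by convention, which contradicts the positive value of
  -- the Beta integral.
  by_contra hn
  have h := setIntegral_beta hx hy ht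
  rw [integral_undef hn] at h
  have := Real.Gamma_pos_of_pos hx
  have := Real.Gamma_pos_of_pos hy
  have := Real.Gamma_pos_of_pos (add_pos hx hy)
  have : 0 < t ^ (x + y - 1) * (Real.Gamma x * Real.Gamma y / Real.Gamma (x + y)) := by positivity
  linarith

theorem integrableOn_fracKer_conv {x y t : ℝ} (hx : 0 < x) (hy : 0 < y) (ht : 0 < t) :
    IntegrableOn (fun s => fracKer y (t - s) • fracKer x s) (Ioo 0 t) := by
  have h : IntegrableOn (fun s => (Real.Gamma y * Real.Gamma x)⁻¹ *
      ((t - s) ^ (y - 1) * s ^ (x - 1))) (Ioo 0 t) := (integrableOn_beta hx hy ht).const_mul _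
  refine h.congr_fun (fun s _ => ?_) measurableSet_Ioo
  simp only [fracKer, smul_eq_mul, div_eq_mul_inv, mul_inv]; ring

theorem vconv_fracKer_fracKer {x y t : ℝ} (hx : 0 < x) (hy : 0 < y) (ht : 0 < t) :
    vconv (fracKer y) (fracKer x) t = fracKer (x + y) t := by
  have h : vconv (fracKer y) (fracKer x) t = (Real.Gamma y * Real.Gamma x)⁻¹ *
      ∫ s in Ioo 0 t, (t - s) ^ (y - 1) * s ^ (x - 1) := by
    rw [vconv, ← integral_const_mul]
    refine setIntegral_congr_fun measurableSet_Ioo fun s _ => ?_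
    simp only [fracKer, smul_eq_mul, div_eq_mul_inv, mul_inv]; ring
  rw [h, setIntegral_beta hx hy ht, fracKer]
  have := Real.Gamma_pos_of_pos hx
  have := Real.Gamma_pos_of_pos hy
  field_simp

section Kernel

variable {ι : Type*} [Fintype ι] {β w : ι → ℝ}

theorem vconv_fracKer_mlPartial (hβ : ∀ i, 0 < β i) (k : ℕ) {x y t : ℝ} (hx : 0 < x) (hy : 0 < y)
    (ht : 0 < t) :
    IntegrableOn (fun s => fracKer y (t - s) • mlPartial β w k x s) (Ioo 0 t) ∧
      vconv (fracKer y) (mlPartial β w k x) t = mlPartial β w k (x + y) t := by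
  induction k generalizing x with
  | zero => exact ⟨integrableOn_fracKer_conv hx hy ht, vconv_fracKer_fracKer hx hy ht⟩
  | succ k ih =>
    have ih' := fun i => ih (x := x + β i) (by have := hβ i; linarith)
    have hconv : ∀ i ∈ Finset.univ, Integrable
        (fun s => w i • (fracKer y (t - s) • mlPartial β w k (x + β i) s))
        (volume.restrict (Ioo 0 t)) := fun i _ => ((ih' i).1).smul (w i)
    have heq : (fun s => fracKer y (t - s) • mlPartial β w (k + 1) x s) =
        fun s => ∑ i, w i • (fracKer y (t - s) • mlPartial β w k (x + β i) s) := by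
      funext s
      simp only [mlPartial, smul_eq_mul, Finset.mul_sum]
      exact Finset.sum_congr rfl fun i _ => by ring
    refine ⟨?_, ?_⟩
    · rw [heq]; exact integrable_finsetSum _ hconv
    · rw [vconv, heq, integral_finsetSum _ hconv, mlPartial]
      refine Finset.sum_congr rfl fun i _ => ?_
      rw [integral_smul, smul_eq_mul, show x + y + β i = x + β i + y by ring, ← (ih' i).2, vconv]

/-- Term by term this is the Beta integral. The geometric bound on the terms makes the integrals of
their absolute values summable, so sum and integral may be exchanged. -/
theorem vconv_fracKer_mlKer (hβ : ∀ i, 0 < β i) {x y t : ℝ} (hx : 0 < x) (hy : 0 < y)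
    (ht : 0 < t) : vconv (fracKer y) (mlKer β w x) t = mlKer β w (x + y) t := by
  obtain ⟨C, hC0, hC⟩ := exists_mlPartial_bound hβ w t hx
  have hG := Real.Gamma_pos_of_pos hx
  have hkey := fun k => vconv_fracKer_mlPartial (w := w) hβ k hx hy ht
  have hsum : Summable fun k =>
      ∫ s in Ioo 0 t, ‖fracKer y (t - s) • mlPartial β w k x s‖ := by
    refine Summable.of_nonneg_of_le (fun k => integral_nonneg fun s => norm_nonneg _)
      (f := fun k : ℕ => C * Real.Gamma x * fracKer (x + y) t * (1 / 2 : ℝ) ^ k) (fun k => ?_)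
      ((summable_geometric_of_lt_one (by norm_num) (by norm_num)).mul_left _)
    have hr : C * Real.Gamma x * fracKer (x + y) t * (1 / 2 : ℝ) ^ k =
        ∫ s in Ioo 0 t, (C * Real.Gamma x * (1 / 2 : ℝ) ^ k) •
          (fracKer y (t - s) • fracKer x s) := by
      rw [integral_smul, ← vconv, vconv_fracKer_fracKer hx hy ht, smul_eq_mul]; ring
    rw [hr]
    refine setIntegral_mono_on (hkey k).1.norm ((integrableOn_fracKer_conv hx hy ht).smul
      (C * Real.Gamma x * (1 / 2 : ℝ) ^ k)) measurableSet_Ioo fun s hs => ?_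
    have h1 := hC k s hs.1 hs.2.le
    have h2 : 0 ≤ fracKer y (t - s) := fracKer_nonneg hy (by linarith [hs.2])
    rw [norm_smul, Real.norm_eq_abs, Real.norm_eq_abs, abs_of_nonneg h2]
    simp only [smul_eq_mul]
    calc fracKer y (t - s) * |mlPartial β w k x s|
        ≤ fracKer y (t - s) * (C * s ^ (x - 1) * (1 / 2) ^ k) := by gcongr
      _ = _ := by simp only [fracKer]; field_simp
  have h := integral_tsum_of_summable_integral_norm (fun k => (hkey k).1) hsum
  rw [mlKer]
  simp only [← (hkey _).2]
  simp only [vconv]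
  rw [h]
  refine setIntegral_congr_fun measurableSet_Ioo fun s hs => ?_
  simp only [mlKer, smul_eq_mul]
  exact tsum_mul_left.symm

theorem integrableOn_fracKer_mlKer (hβ : ∀ i, 0 < β i) {x y t : ℝ} (hx : 0 < x) (hy : 0 < y)
    (ht : 0 < t) : IntegrableOn (fun s => fracKer y (t - s) • mlKer β w x s) (Ioo 0 t) := by
  obtain ⟨C, hC0, hC⟩ := exists_mlKer_bound hβ w t hx
  have hG := Real.Gamma_pos_of_pos hx
  refine Integrable.mono' ((integrableOn_fracKer_conv hx hy ht).const_mul (C * Real.Gamma x)) ?_ ?_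
  · refine ContinuousOn.aestronglyMeasurable (ContinuousOn.fun_smul ?_ ?_) measurableSet_Ioo
    · exact (continuousOn_fracKer y).comp (by fun_prop) fun s hs => sub_pos.2 hs.2
    · exact (continuousOn_mlKer hβ hx).mono Ioo_subset_Ioi_self
  · filter_upwards [self_mem_ae_restrict measurableSet_Ioo] with s hs
    have h2 : 0 ≤ fracKer y (t - s) := fracKer_nonneg hy (by linarith [hs.2])
    rw [norm_smul, Real.norm_eq_abs, Real.norm_eq_abs, abs_of_nonneg h2]
    calc _ ≤ fracKer y (t - s) * (C * s ^ (x - 1)) := by gcongr; exact hC s hs.1 hs.2.le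
      _ = _ := by simp only [fracKer, smul_eq_mul]; field_simp

end Kernel

/-! ### Positivity of the kernels -/

/-- Here (u − s)/(t − s) ≥ u/t ≥ 1 and p − 1 ≤ x − 1 ≤ 0. The factor (u/t)^{x-1} is exactly the one
by which `fracKer x` changes from t to u, so the memory kernels decay at least as much as the free
term. -/
theorem rpow_sub_mul_le {s t u p x : ℝ} (hs : 0 ≤ s) (hst : s < t) (htu : t ≤ u) (hpx : p ≤ x)
    (hx : x ≤ 1) : (u - s) ^ (p - 1) ≤ (u / t) ^ (x - 1) * (t - s) ^ (p - 1) := by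
  have ht : 0 < t := by linarith
  have h1 : 0 < t - s := by linarith
  have h2 : 0 < u - s := by linarith
  have h3 : 1 ≤ u / t := by rwa [one_le_div ht]
  have h4 : u / t ≤ (u - s) / (t - s) := by
    rw [div_le_div_iff₀ ht h1]; nlinarith
  rw [← div_le_iff₀ (Real.rpow_pos_of_pos h1 _), ← Real.div_rpow h2.le h1.le]
  calc ((u - s) / (t - s)) ^ (p - 1) ≤ (u / t) ^ (p - 1) :=
        Real.rpow_le_rpow_of_nonpos (by linarith) h4 (by linarith)
    _ ≤ (u / t) ^ (x - 1) := Real.rpow_le_rpow_of_exponent_le h3 (by linarith)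

theorem setIntegral_fracKer_sub {p t u : ℝ} (hp : 0 < p) (htu : t ≤ u) :
    IntegrableOn (fun s => fracKer p (u - s)) (Ico t u) ∧
      ∫ s in Ico t u, fracKer p (u - s) = (u - t) ^ p / (p * Real.Gamma p) := by
  have hi : IntervalIntegrable (fun s : ℝ => s ^ (p - 1)) volume 0 (u - t) :=
    intervalIntegral.intervalIntegrable_rpow' (by linarith)
  have hi' := (hi.comp_sub_left u).symm
  simp only [sub_sub_cancel, sub_zero] at hi'
  rw [intervalIntegrable_iff_integrableOn_Ico_of_le htu] at hi'
  refine ⟨hi'.div_const _, ?_⟩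
  rw [integral_Ico_eq_integral_Ioo, ← integral_Ioc_eq_integral_Ioo,
    ← intervalIntegral.integral_of_le htu]
  rw [intervalIntegral.integral_comp_sub_left (fun s => fracKer p s) u]
  simp only [fracKer, sub_self, intervalIntegral.integral_div]
  rw [integral_rpow (Or.inl (by linarith))]
  simp [Real.zero_rpow hp.ne', div_div]

section Kernel

variable {ι : Type*} [Fintype ι] {β w : ι → ℝ}

theorem mlKer_volterra (hβ : ∀ i, 0 < β i) {x t : ℝ} (hx : 0 < x) (ht : 0 < t) :
    mlKer β w x t = fracKer x t + ∑ i, w i * vconv (fracKer (β i)) (mlKer β w x) t := by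
  rw [mlKer_eq_add hβ hx ht]
  congr 1
  exact Finset.sum_congr rfl fun i _ => by rw [vconv_fracKer_mlKer hβ hx (hβ i) ht]

/-- Near 0 the leading term t^{x-1}/Γ(x) wins, since every other term carries an extra factor
t^{βᵢ}. -/
theorem eventually_mlKer_pos (hβ : ∀ i, 0 < β i) {x : ℝ} (hx : 0 < x) :
    ∃ δ > 0, ∀ t, 0 < t → t < δ → 0 < mlKer β w x t := by
  choose C hC0 hC using fun i => exists_mlKer_bound hβ w 1 (x := x + β i)
    (by have := hβ i; linarith)
  have h1 : Filter.Tendsto (fun t : ℝ => ∑ i, |w i| * (C i * t ^ β i)) (nhds 0) (nhds 0) := by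
    have : (0 : ℝ) = ∑ i, |w i| * (C i * 0) := by simp
    nth_rw 2 [this]
    refine tendsto_finsetSum _ fun i _ => Filter.Tendsto.const_mul _ (Filter.Tendsto.const_mul _ ?_)
    have h := (Real.continuousAt_rpow_const 0 (β i) (Or.inr (hβ i).le)).tendsto
    rwa [Real.zero_rpow (hβ i).ne'] at h
  have hG := Real.Gamma_pos_of_pos hx
  have h2 := h1.eventually (gt_mem_nhds (inv_pos.2 hG))
  obtain ⟨δ, hδ, h3⟩ := Metric.eventually_nhds_iff.1 h2
  refine ⟨min δ 1, lt_min hδ one_pos, fun t ht htδ => ?_⟩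
  have h4 := h3 (y := t) (by
    rw [Real.dist_eq, sub_zero, abs_of_pos ht]; exact htδ.trans_le (min_le_left _ _))
  have ht1 : t ≤ 1 := (htδ.trans_le (min_le_right _ _)).le
  rw [mlKer_eq_add hβ hx ht]
  have h5 : -(∑ i, |w i| * (C i * t ^ β i)) * t ^ (x - 1) ≤
      ∑ i, w i * mlKer β w (x + β i) t := by
    rw [← Finset.sum_neg_distrib, Finset.sum_mul]
    refine Finset.sum_le_sum fun i _ => ?_
    have h6 := hC i t ht ht1
    rw [show x + β i - 1 = β i + (x - 1) by ring, Real.rpow_add ht] at h6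
    have h7 : |w i * mlKer β w (x + β i) t| ≤ |w i| * (C i * (t ^ β i * t ^ (x - 1))) := by
      rw [abs_mul]; gcongr
    have := neg_abs_le (w i * mlKer β w (x + β i) t)
    linarith
  have h8 : 0 < t ^ (x - 1) := Real.rpow_pos_of_pos ht _
  rw [fracKer, div_eq_inv_mul]
  nlinarith

/-- Subtract (u/t)^{x-1} times the Volterra equation at t from the equation at u. The free terms
cancel. The history on (0, t) contributes with a favourable sign, by `rpow_sub_mul_le`, wᵢ ≤ 0 and
nonnegativity of the kernel before u. Only the memory on [t, u) is left. -/
theorem mlKer_ge_of_nonneg (hβ : ∀ i, 0 < β i) (hw : ∀ i, w i ≤ 0) {x : ℝ} (hx : 0 < x)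
    (hx1 : x ≤ 1) (hβx : ∀ i, β i ≤ x) {t u : ℝ} (ht : 0 < t) (htu : t < u)
    (hpos : ∀ s, 0 < s → s < u → 0 ≤ mlKer β w x s) :
    (u / t) ^ (x - 1) * mlKer β w x t +
      ∑ i, w i * ∫ s in Ico t u, fracKer (β i) (u - s) • mlKer β w x s ≤ mlKer β w x u := by
  have hu : 0 < u := ht.trans htu
  rw [mlKer_volterra hβ hx ht, mlKer_volterra hβ hx hu, mul_add, Finset.mul_sum, add_assoc,
    ← Finset.sum_add_distrib]
  refine add_le_add (le_of_eq ?_) (Finset.sum_le_sum fun i _ => ?_)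
  · rw [fracKer, fracKer, Real.div_rpow hu.le ht.le]
    have := Real.rpow_pos_of_pos ht (x - 1)
    field_simp
  have hconv := integrableOn_fracKer_mlKer (w := w) hβ hx (hβ i) hu
  have hsplit : Ioo 0 u = Ioo 0 t ∪ Ico t u := (Ioo_union_Ico_eq_Ioo ht htu.le).symm
  have h1 : vconv (fracKer (β i)) (mlKer β w x) u =
      (∫ s in Ioo 0 t, fracKer (β i) (u - s) • mlKer β w x s) +
      ∫ s in Ico t u, fracKer (β i) (u - s) • mlKer β w x s := by
    rw [vconv, hsplit]
    refine setIntegral_union ?_ measurableSet_Ico (hconv.mono_set ?_) (hconv.mono_set ?_)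
    · rw [Set.disjoint_left]; intro s hs hs'; exact absurd hs.2 (not_lt.2 hs'.1)
    · rw [hsplit]; exact subset_union_left
    · rw [hsplit]; exact subset_union_right
  have h2 : ∫ s in Ioo 0 t, fracKer (β i) (u - s) • mlKer β w x s ≤
      (u / t) ^ (x - 1) * vconv (fracKer (β i)) (mlKer β w x) t := by
    rw [vconv, ← integral_const_mul]
    refine setIntegral_mono_on (hconv.mono_set ?_)
      ((integrableOn_fracKer_mlKer (w := w) hβ hx (hβ i) ht).const_mul _) measurableSet_Ioo ?_
    · exact Ioo_subset_Ioo_right htu.le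
    · intro s hs
      have h3 := rpow_sub_mul_le hs.1.le hs.2 htu.le (hβx i) hx1
      have h4 := hpos s hs.1 (hs.2.trans htu)
      have hG := Real.Gamma_pos_of_pos (hβ i)
      simp only [fracKer, smul_eq_mul]
      rw [← mul_assoc, ← mul_div_assoc]
      gcongr
  rw [h1]
  have := mul_le_mul_of_nonpos_left h2 (hw i)
  linarith

/-- Suppose u is the first zero. Take r < u close to u and let v maximize the kernel K on [r, u].
Comparing v with u through `mlKer_ge_of_nonneg` gives K(u) ≥ (1/2 − η(r)) K(v) > 0, a contradiction;
maximality of v is what bounds the memory on [v, u) by K(v). -/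
theorem mlKer_pos (hβ : ∀ i, 0 < β i) (hw : ∀ i, w i ≤ 0) {x : ℝ} (hx : 0 < x)
    (hx1 : x ≤ 1) (hβx : ∀ i, β i ≤ x) {t : ℝ} (ht : 0 < t) : 0 < mlKer β w x t := by
  by_contra! hcon
  obtain ⟨δ, hδ, hδpos⟩ := eventually_mlKer_pos (w := w) hβ hx
  have hδt : δ ≤ t := by
    by_contra! h
    exact absurd (hδpos t ht h) (not_lt.2 hcon)
  have hcont : ∀ {c d : ℝ}, 0 < c → ContinuousOn (mlKer β w x) (Icc c d) := fun hc =>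
    (continuousOn_mlKer hβ hx).mono fun s hs => lt_of_lt_of_le hc hs.1
  have hcomp : IsCompact (Icc δ t ∩ mlKer β w x ⁻¹' Iic 0) :=
    isCompact_Icc.of_isClosed_subset
      ((hcont hδ).preimage_isClosed_of_isClosed isClosed_Icc isClosed_Iic) inter_subset_left
  obtain ⟨u, ⟨⟨hu1, hu2⟩, hKu⟩, hleast⟩ := hcomp.exists_isLeast ⟨t, ⟨hδt, le_rfl⟩, hcon⟩
  replace hKu : mlKer β w x u ≤ 0 := hKu
  have hu : 0 < u := hδ.trans_le hu1
  have hposu : ∀ s, 0 < s → s < u → 0 < mlKer β w x s := by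
    intro s hs hsu
    rcases lt_or_ge s δ with h | h
    · exact hδpos s hs h
    · by_contra! h'
      exact absurd (hleast ⟨⟨h, hsu.le.trans hu2⟩, h'⟩) (not_le.2 hsu)
  -- η(r) is the weighted mass of the memory kernels over (r, u), which tends to 0 as r → u.
  let η : ℝ → ℝ := fun r => ∑ i, |w i| * ((u - r) ^ β i / (β i * Real.Gamma (β i)))
  have hη : Filter.Tendsto η (nhdsWithin u (Iio u)) (nhds 0) := by
    have : (0 : ℝ) = ∑ i, |w i| * (0 / (β i * Real.Gamma (β i))) := by simp
    rw [this]
    refine tendsto_finsetSum _ fun i _ => Filter.Tendsto.const_mul _ (Filter.Tendsto.div_const ?_ _)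
    have h : ContinuousAt (fun r : ℝ => (u - r) ^ β i) u :=
      ContinuousAt.rpow_const (by fun_prop) (Or.inr (hβ i).le)
    have h' := h.tendsto
    rw [sub_self, Real.zero_rpow (hβ i).ne'] at h'
    exact h'.mono_left nhdsWithin_le_nhds
  -- The condition r > u/2 keeps u/v below 2, so that (u/v)^{x-1} ≥ (u/v)^{-1} ≥ 1/2.
  have hev := (hη.eventually (gt_mem_nhds (show (0 : ℝ) < 1 / 2 by norm_num))).and
    (Ioo_mem_nhdsLT (show u / 2 < u by linarith))
  obtain ⟨r, hr, hr1, hr2⟩ := hev.exists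
  have hr0 : 0 < r := by linarith
  obtain ⟨v, ⟨hv1, hv2⟩, hvmax⟩ := isCompact_Icc.exists_isMaxOn ⟨r, le_rfl, hr2.le⟩ (hcont hr0)
  have hKr := hposu r hr0 hr2
  have hKv : 0 < mlKer β w x v := hKr.trans_le (hvmax ⟨le_rfl, hr2.le⟩)
  have hvu : v < u := lt_of_le_of_ne hv2 (by rintro rfl; linarith)
  have hv0 : 0 < v := by linarith
  have hmain := mlKer_ge_of_nonneg hβ hw hx hx1 hβx hv0 hvu (fun s h h' => (hposu s h h').le)
  have hratio : 1 / 2 ≤ (u / v) ^ (x - 1) := by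
    have h1 : 1 ≤ u / v := by rw [one_le_div hv0]; exact hvu.le
    calc (1 / 2 : ℝ) ≤ (u / v)⁻¹ := by
          rw [inv_div, div_le_div_iff₀ two_pos hu]; linarith
      _ = (u / v) ^ (-1 : ℝ) := (Real.rpow_neg_one _).symm
      _ ≤ _ := Real.rpow_le_rpow_of_exponent_le h1 (by linarith)
  have hsum : -(mlKer β w x v * η r) ≤
      ∑ i, w i * ∫ s in Ico v u, fracKer (β i) (u - s) • mlKer β w x s := by
    simp only [η]
    rw [Finset.mul_sum, ← Finset.sum_neg_distrib]
    refine Finset.sum_le_sum fun i _ => ?_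
    have hG := Real.Gamma_pos_of_pos (hβ i)
    have hb := hβ i
    have h1 : ∫ s in Ico v u, fracKer (β i) (u - s) • mlKer β w x s ≤
        ∫ s in Ico v u, mlKer β w x v * fracKer (β i) (u - s) := by
      refine setIntegral_mono_on ((integrableOn_fracKer_mlKer (w := w) hβ hx hb hu).mono_set ?_)
        ((setIntegral_fracKer_sub hb hvu.le).1.const_mul _) measurableSet_Ico ?_
      · exact fun s hs => ⟨hv0.trans_le hs.1, hs.2⟩
      · intro s hs
        rw [smul_eq_mul, mul_comm]
        exact mul_le_mul_of_nonneg_right (hvmax ⟨hv1.trans hs.1, hs.2.le⟩)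
          (fracKer_nonneg hb (by linarith [hs.2]))
    rw [integral_const_mul, (setIntegral_fracKer_sub hb hvu.le).2] at h1
    have h2 : (u - v) ^ β i / (β i * Real.Gamma (β i)) ≤
        (u - r) ^ β i / (β i * Real.Gamma (β i)) := by
      have : 0 ≤ u - v := by linarith
      gcongr
    have h3 := h1.trans (mul_le_mul_of_nonneg_left h2 hKv.le)
    have h4 := mul_le_mul_of_nonpos_left h3 (hw i)
    rw [abs_of_nonpos (hw i)]
    linarith
  nlinarith

/-! ### Convolution identities between the kernels -/

theorem ae_vconv_mlKer_expand {X : Type*} [NormedAddCommGroup X] [NormedSpace ℝ X]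
    (hβ : ∀ i, 0 < β i) {x : ℝ} (hx : 0 < x) {T : ℝ} {v : ℝ → X}
    (hv : IntegrableOn v (Ioo 0 T)) :
    ∀ᵐ t ∂(volume.restrict (Ioo 0 T)), vconv (mlKer β w x) v t =
      vconv (fracKer x) v t + ∑ i, w i • vconv (mlKer β w (x + β i)) v t := by
  have h1 : mlKer β w x =ᵐ[volume.restrict (Ioo 0 T)]
      fun t => fracKer x t + ∑ i, w i * mlKer β w (x + β i) t := by
    filter_upwards [self_mem_ae_restrict measurableSet_Ioo] with t ht
    exact mlKer_eq_add hβ hx ht.1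
  have hxi : ∀ i, 0 < x + β i := fun i => by have := hβ i; linarith
  filter_upwards [self_mem_ae_restrict measurableSet_Ioo,
    ae_integrableOn_vconv (integrableOn_fracKer hx T) hv,
    ae_all_iff.2 fun i => ae_integrableOn_vconv (integrableOn_mlKer (w := w) hβ (hxi i) T) hv]
    with t ht h2 h3
  rw [vconv_congr h1 (Filter.EventuallyEq.refl _ v) ht.2.le,
    vconv_add_left h2 (integrableOn_sum_left _ w fun i _ => h3 i),
    vconv_sum_left _ w fun i _ => h3 i]

theorem ae_vconv_mlKer_shift {w' : ι → ℝ} (hβ : ∀ i, 0 < β i) {x y γ : ℝ} (hx : 0 < x)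
    (hy : 0 < y) (hγ : 0 < γ) (T : ℝ) :
    ∀ᵐ t ∂(volume.restrict (Ioo 0 T)), vconv (mlKer β w (x + γ)) (mlKer β w' y) t =
      vconv (mlKer β w x) (mlKer β w' (y + γ)) t := by
  have h1 : mlKer β w (x + γ) =ᵐ[volume.restrict (Ioo 0 T)]
      vconv (mlKer β w x) (fracKer γ) := by
    filter_upwards [self_mem_ae_restrict measurableSet_Ioo] with t ht
    rw [vconv_comm, vconv_fracKer_mlKer hβ hx hγ ht.1]
  have h2 : mlKer β w' (y + γ) =ᵐ[volume.restrict (Ioo 0 T)]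
      vconv (fracKer γ) (mlKer β w' y) := by
    filter_upwards [self_mem_ae_restrict measurableSet_Ioo] with t ht
    rw [vconv_fracKer_mlKer hβ hy hγ ht.1]
  filter_upwards [self_mem_ae_restrict measurableSet_Ioo,
    vconv_assoc (integrableOn_mlKer (w := w) hβ hx T) (integrableOn_fracKer hγ T)
      (integrableOn_mlKer (w := w') hβ hy T)] with t ht h3
  rw [vconv_congr h1 (Filter.EventuallyEq.refl _ _) ht.2.le, h3,
    vconv_congr (Filter.EventuallyEq.refl _ _) h2 ht.2.le]

/-- The resolvent identity for two kernels with the same exponents. -/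
theorem ae_mlKer_sub_mlKer {w' : ι → ℝ} (hβ : ∀ i, 0 < β i) {x : ℝ} (hx : 0 < x) (T : ℝ) :
    ∀ᵐ t ∂(volume.restrict (Ioo 0 T)), mlKer β w x t - mlKer β w' x t =
      ∑ i, (w i - w' i) * vconv (mlKer β w (x / 2)) (mlKer β w' (x / 2 + β i)) t := by
  have hx2 : 0 < x / 2 := by positivity
  have hi := fun (w : ι → ℝ) => integrableOn_mlKer (w := w) hβ hx2 T
  filter_upwards [self_mem_ae_restrict measurableSet_Ioo,
    ae_vconv_mlKer_expand (w := w) hβ hx2 (hi w'), ae_vconv_mlKer_expand (w := w') hβ hx2 (hi w),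
    ae_all_iff.2 fun i => ae_vconv_mlKer_shift (w := w) (w' := w') hβ hx2 hx2 (hβ i) T]
    with t ht h1 h2 h3
  -- The convolution of the two kernels of index x/2 is expanded in either factor. Halving the index
  -- makes the two leading terms the kernels of index x themselves.
  rw [vconv_comm, h2, vconv_fracKer_mlKer hβ hx2 hx2 ht.1, vconv_fracKer_mlKer hβ hx2 hx2 ht.1,
    add_halves] at h1
  simp only [h3, smul_eq_mul] at h1
  simp only [vconv_comm (mlKer β w' _) (mlKer β w _)] at h1
  simp only [sub_mul, Finset.sum_sub_distrib]
  linarith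

end Kernel

/-! ### The multi-term kernel -/

section MultiTerm

variable {m : ℕ} {α : ℝ} {a b : Fin m → ℝ}

theorem multiExp_pos (hα0 : 0 < α) (ha : ∀ i, 0 < a i ∧ a i < α) (i : Fin (m + 1)) :
    0 < multiExp α a i := by
  refine Fin.cases ?_ (fun i => ?_) i
  · simpa [multiExp]
  · simpa [multiExp] using (ha i).2

theorem multiExp_le (ha : ∀ i, 0 < a i ∧ a i < α) (i : Fin (m + 1)) :
    multiExp α a i ≤ α := by
  refine Fin.cases ?_ (fun i => ?_) i
  · simp [multiExp]
  · simpa [multiExp] using (ha i).1.le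

theorem multiCoef_nonpos (hb : ∀ i, 0 < b i) {μ : ℝ} (hμ : 0 ≤ μ) (i : Fin (m + 1)) :
    multiCoef b μ i ≤ 0 := by
  refine Fin.cases ?_ (fun i => ?_) i
  · simpa [multiCoef]
  · simpa [multiCoef] using (hb i).le

theorem multiKer_pos (hα0 : 0 < α) (hα1 : α < 1) (ha : ∀ i, 0 < a i ∧ a i < α)
    (hb : ∀ i, 0 < b i) {μ t : ℝ} (hμ : 0 ≤ μ) (ht : 0 < t) :
    0 < mlKer (multiExp α a) (multiCoef b μ) α t :=
  mlKer_pos (multiExp_pos hα0 ha) (multiCoef_nonpos hb hμ) hα0 hα1.le (multiExp_le ha) ht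

/-- Only the coefficient attached to the exponent α depends on μ, so a single term of the general
identity survives. Shifting α/2 from one factor to the other restores the index α in both. -/
theorem ae_multiKer_resolvent (hα0 : 0 < α) (ha : ∀ i, 0 < a i ∧ a i < α) (μ T : ℝ) :
    ∀ᵐ t ∂(volume.restrict (Ioo 0 T)),
      mlKer (multiExp α a) (multiCoef b 0) α t - mlKer (multiExp α a) (multiCoef b μ) α t =
      μ * vconv (mlKer (multiExp α a) (multiCoef b 0) α)
        (mlKer (multiExp α a) (multiCoef b μ) α) t := by
  have hβ := multiExp_pos hα0 ha
  have hα2 : 0 < α / 2 := by positivity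
  filter_upwards [ae_mlKer_sub_mlKer (w := multiCoef b 0) (w' := multiCoef b μ) hβ hα0 T,
    ae_vconv_mlKer_shift (w := multiCoef b 0) (w' := multiCoef b μ) hβ hα2 hα0 hα2 T] with t h1 h2
  rw [h1, Fin.sum_univ_succ]
  rw [add_halves, add_comm α] at h2
  have h3 : ∀ i : Fin m, multiCoef b 0 i.succ - multiCoef b μ i.succ = 0 := fun i => by
    simp [multiCoef]
  have h4 : multiCoef b 0 0 - multiCoef b μ 0 = μ := by simp [multiCoef]
  have h5 : multiExp α a 0 = α := rfl
  simp only [h3, h4, zero_mul, Finset.sum_const_zero, add_zero]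
  rw [h5, h2]

/-- With both kernels positive, the right side of the resolvent identity is nonnegative. The kernel
for μ = 0 is thus a common majorant of all modes. -/
theorem ae_multiKer_le (hα0 : 0 < α) (hα1 : α < 1) (ha : ∀ i, 0 < a i ∧ a i < α)
    (hb : ∀ i, 0 < b i) {μ : ℝ} (hμ : 0 ≤ μ) (T : ℝ) :
    ∀ᵐ t ∂(volume.restrict (Ioo 0 T)), mlKer (multiExp α a) (multiCoef b μ) α t ≤
      mlKer (multiExp α a) (multiCoef b 0) α t := by
  filter_upwards [ae_multiKer_resolvent (b := b) hα0 ha μ T] with t h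
  have h1 : 0 ≤ vconv (mlKer (multiExp α a) (multiCoef b 0) α)
        (mlKer (multiExp α a) (multiCoef b μ) α) t :=
    setIntegral_nonneg measurableSet_Ioo fun s hs => mul_nonneg
      (multiKer_pos hα0 hα1 ha hb le_rfl (sub_pos.2 hs.2)).le
      (multiKer_pos hα0 hα1 ha hb hμ hs.1).le
  have := mul_nonneg hμ h1
  linarith

/-- Integration raises the index from α to α + 1. Writing M_x for the kernel of index x, the
recursion at index 1 reads M_1 + μ M_{1+α} + ∑ bᵢ M_{1+α-αᵢ} = 1. Each term is nonnegative, because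
every index exceeds α and the kernel is therefore a fractional integral of a positive one. -/
theorem mul_setIntegral_multiKer_le (hα0 : 0 < α) (hα1 : α < 1) (ha : ∀ i, 0 < a i ∧ a i < α)
    (hb : ∀ i, 0 < b i) {μ t : ℝ} (hμ : 0 ≤ μ) (ht : 0 < t) :
    μ * ∫ s in Ioo 0 t, mlKer (multiExp α a) (multiCoef b μ) α s ≤ 1 := by
  have hβ := multiExp_pos hα0 ha
  have hnn : ∀ y, 0 < y → 0 ≤ mlKer (multiExp α a) (multiCoef b μ) (α + y) t := by
    intro y hy
    rw [← vconv_fracKer_mlKer hβ hα0 hy ht]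
    exact setIntegral_nonneg measurableSet_Ioo fun s hs => mul_nonneg
      (fracKer_nonneg hy (sub_pos.2 hs.2).le) (multiKer_pos hα0 hα1 ha hb hμ hs.1).le
  have h1 : ∫ s in Ioo 0 t, mlKer (multiExp α a) (multiCoef b μ) α s =
      mlKer (multiExp α a) (multiCoef b μ) (α + 1) t := by
    rw [← vconv_fracKer_mlKer hβ hα0 one_pos ht]
    simp [vconv, fracKer_one]
  have h2 := mlKer_eq_add (w := multiCoef b μ) hβ one_pos ht
  rw [fracKer_one, Fin.sum_univ_succ] at h2
  have h3 := hnn (1 - α) (by linarith)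
  have h4 : ∀ i : Fin m, multiCoef b μ i.succ *
      mlKer (multiExp α a) (multiCoef b μ) (1 + multiExp α a i.succ) t ≤ 0 := by
    intro i
    refine mul_nonpos_of_nonpos_of_nonneg (multiCoef_nonpos hb hμ _) ?_
    have := hnn (1 - a i) (by linarith [(ha i).2])
    rwa [show α + (1 - a i) = 1 + multiExp α a i.succ by simp [multiExp]; ring] at this
  have h5 := Finset.sum_nonpos fun i (_ : i ∈ Finset.univ) => h4 i
  rw [show α + (1 - α) = 1 by ring] at h3
  have h6 : multiCoef b μ 0 = -μ := rfl
  have h7 : multiExp α a 0 = α := rfl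
  rw [h6, h7] at h2
  rw [h1, add_comm α 1]
  linarith

end MultiTerm

/-! ### The Poincaré inequality -/

/-- Integrating by parts against the coordinate xᵢ gives ∫ψ² = −∫ 2 xᵢ ψ ∂ᵢψ. The integrand is at
most ψ²/2 + 2R²|∇ψ|², and the first part is absorbed. -/
theorem integral_sq_le_of_bounded_support {d : ℕ} (i : Fin d) {R : ℝ}
    {ψ : EuclideanSpace ℝ (Fin d) → ℝ} (hψ : ContDiff ℝ ∞ ψ) (hc : HasCompactSupport ψ)
    (hR : ∀ x ∈ tsupport ψ, |x i| ≤ R) :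
    ∫ x, ψ x ^ 2 ≤ 4 * R ^ 2 * ∫ x, ‖gradient ψ x‖ ^ 2 := by
  have hdiff : Differentiable ℝ ψ := hψ.differentiable (by simp)
  have hcont : Continuous ψ := hψ.continuous
  have hcf : Continuous (fderiv ℝ ψ) := hψ.continuous_fderiv (by simp)
  let v : EuclideanSpace ℝ (Fin d) := EuclideanSpace.single i 1
  have hv : ‖v‖ = 1 := by simp [v]
  let f : EuclideanSpace ℝ (Fin d) →L[ℝ] ℝ := EuclideanSpace.proj i
  have hfv : f v = 1 := by simp [f, v]
  have hg' : ∀ x, fderiv ℝ (fun x => ψ x ^ 2) x v = 2 * ψ x * fderiv ℝ ψ x v := by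
    intro x
    have h := ((hdiff x).hasFDerivAt.pow 2).fderiv
    have h' : fderiv ℝ (fun x => ψ x ^ 2) x = (2 * ψ x ^ (2 - 1)) • fderiv ℝ ψ x := by
      simpa using h
    rw [h']; simp
  have hsq : HasCompactSupport fun x => ψ x ^ 2 :=
    hc.comp_left (g := fun y : ℝ => y ^ 2) (by simp)
  have hf1 : ∀ x, fderiv ℝ (fun x => f x) x v = 1 := by
    intro x; rw [f.fderiv]; exact hfv
  have i1 : Integrable fun x => ψ x ^ 2 := (hcont.pow 2).integrable_of_hasCompactSupport hsq
  have i2 : Integrable fun x => f x * (2 * ψ x * fderiv ℝ ψ x v) := by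
    refine Continuous.integrable_of_hasCompactSupport (by fun_prop) ?_
    exact HasCompactSupport.mul_left ((hc.mul_left (f := fun _ => (2 : ℝ))).mul_right)
  have i3 : Integrable fun x => f x * ψ x ^ 2 :=
    Continuous.integrable_of_hasCompactSupport (by fun_prop) hsq.mul_left
  have i4 : Integrable fun x => ‖gradient ψ x‖ ^ 2 := by
    have : (fun x => ‖gradient ψ x‖ ^ 2) = fun x => ‖fderiv ℝ ψ x‖ ^ 2 := by
      funext x; rw [gradient, LinearIsometryEquiv.norm_map]
    rw [this]
    refine Continuous.integrable_of_hasCompactSupport (by fun_prop) ?_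
    exact (hc.fderiv (𝕜 := ℝ)).comp_left (g := fun L => ‖L‖ ^ 2) (by simp)
  have hparts := integral_mul_fderiv_eq_neg_fderiv_mul_of_integrable (μ := volume)
    (f := fun x => f x) (g := fun x => ψ x ^ 2) (v := v)
    (by simpa only [hf1, one_mul] using i1) (by simpa only [hg'] using i2) i3
    (fun x _ => f.differentiableAt) (fun x _ => (hdiff x).pow 2)
  simp only [hf1, one_mul, hg'] at hparts
  have hbound : ∫ x, ψ x ^ 2 ≤ ∫ x, (1 / 2 * ψ x ^ 2 + 2 * R ^ 2 * ‖gradient ψ x‖ ^ 2) := by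
    have : ∫ x, ψ x ^ 2 = ∫ x, -(f x * (2 * ψ x * fderiv ℝ ψ x v)) := by
      rw [integral_neg, hparts, neg_neg]
    rw [this]
    refine integral_mono i2.neg ((i1.const_mul _).add (i4.const_mul _)) fun x => ?_
    simp only
    by_cases hx : x ∈ tsupport ψ
    · have h1 : |fderiv ℝ ψ x v| ≤ ‖gradient ψ x‖ := by
        rw [gradient, LinearIsometryEquiv.norm_map]
        simpa [hv] using (fderiv ℝ ψ x).le_opNorm v
      have h2 : |f x| ≤ R := hR x hx
      have hR0 : 0 ≤ R := (abs_nonneg _).trans h2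
      have h3 : |f x * fderiv ℝ ψ x v| ≤ R * ‖gradient ψ x‖ := by
        rw [abs_mul]; gcongr
      have h4 := sq_abs (ψ x)
      have h5 : -(f x * (2 * ψ x * fderiv ℝ ψ x v)) ≤
          2 * |ψ x| * |f x * fderiv ℝ ψ x v| := by
        have := neg_abs_le (ψ x * (f x * fderiv ℝ ψ x v))
        rw [abs_mul] at this
        linarith
      nlinarith [sq_nonneg (|ψ x| - 2 * (R * ‖gradient ψ x‖)),
        mul_le_mul_of_nonneg_left h3 (abs_nonneg (ψ x))]
    · rw [image_eq_zero_of_notMem_tsupport hx]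
      simp only [mul_zero, zero_mul, neg_zero]
      positivity
  rw [integral_add (i1.const_mul _) (i4.const_mul _), integral_const_mul, integral_const_mul]
    at hbound
  linarith

theorem norm_sq_eq_integral_of_ae_eq {d : ℕ} {Ω : Set (EuclideanSpace ℝ (Fin d))}
    {F : Type*} [NormedAddCommGroup F] [InnerProductSpace ℝ F]
    {p : Lp F 2 (volume.restrict Ω)} {ψ : EuclideanSpace ℝ (Fin d) → F}
    (hp : p =ᵐ[volume.restrict Ω] ψ) (hs : Function.support ψ ⊆ Ω) :
    ‖p‖ ^ 2 = ∫ x, ‖ψ x‖ ^ 2 := by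
  rw [← real_inner_self_eq_norm_sq, L2.inner_def]
  have h1 : ∫ x, ‖ψ x‖ ^ 2 = ∫ x in Ω, ‖ψ x‖ ^ 2 := by
    rw [setIntegral_eq_integral_of_forall_compl_eq_zero]
    intro x hx
    have : ψ x = 0 := by by_contra h; exact hx (hs h)
    simp [this]
  rw [h1]
  refine integral_congr_ae ?_
  filter_upwards [hp] with x hx
  rw [hx, real_inner_self_eq_norm_sq]

/-- The inequality is a closed condition on (w, ∇w), so test functions suffice. It is not preserved
by sums, hence the check that the span adds nothing: test-function pairs already form a linear
space. -/
theorem exists_poincare {d : ℕ} (hd : 1 ≤ d) {Ω : Set (EuclideanSpace ℝ (Fin d))}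
    (hΩ : Bornology.IsBounded Ω) :
    ∃ C : ℝ, 0 < C ∧ ∀ w : H10 Ω, ‖w.val‖ ^ 2 ≤ C * ‖w.grad‖ ^ 2 := by
  obtain ⟨R, hR0, hR⟩ := hΩ.exists_pos_norm_le
  refine ⟨4 * R ^ 2, by positivity, fun w => ?_⟩
  let i : Fin d := ⟨0, hd⟩
  have hclosed : IsClosed {p : WithLp 2 (L2 Ω × L2Vec Ω) |
      ‖p.fst‖ ^ 2 ≤ 4 * R ^ 2 * ‖p.snd‖ ^ 2} := by
    have h1 : Continuous fun p : WithLp 2 (L2 Ω × L2Vec Ω) => p.fst :=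
      (WithLp.fstL 2 ℝ (L2 Ω) (L2Vec Ω)).continuous
    have h2 : Continuous fun p : WithLp 2 (L2 Ω × L2Vec Ω) => p.snd :=
      (WithLp.sndL 2 ℝ (L2 Ω) (L2Vec Ω)).continuous
    exact isClosed_le (by fun_prop) (by fun_prop)
  have hspan : ∀ p ∈ Submodule.span ℝ {p : WithLp 2 (L2 Ω × L2Vec Ω) |
      ∃ ψ : EuclideanSpace ℝ (Fin d) → ℝ,
        ContDiff ℝ ∞ ψ ∧ HasCompactSupport ψ ∧ tsupport ψ ⊆ Ω ∧
        p.fst =ᵐ[volume.restrict Ω] ψ ∧ p.snd =ᵐ[volume.restrict Ω] gradient ψ},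
      ∃ ψ : EuclideanSpace ℝ (Fin d) → ℝ,
        ContDiff ℝ ∞ ψ ∧ HasCompactSupport ψ ∧ tsupport ψ ⊆ Ω ∧
        p.fst =ᵐ[volume.restrict Ω] ψ ∧ p.snd =ᵐ[volume.restrict Ω] gradient ψ := by
    intro p hp
    induction hp using Submodule.span_induction with
    | mem p hp => exact hp
    | zero =>
      refine ⟨fun _ => 0, contDiff_const, HasCompactSupport.zero, ?_, ?_, ?_⟩
      · simp [tsupport, Function.support]
      · exact Lp.coeFn_zero _ _ _
      · have : gradient (fun _ : EuclideanSpace ℝ (Fin d) => (0 : ℝ)) = 0 := by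
          funext x; simp [gradient]
        rw [this]; exact Lp.coeFn_zero _ _ _
    | add p p' _ _ h h' =>
      obtain ⟨ψ, h1, h2, h3, h4, h5⟩ := h
      obtain ⟨ψ', h1', h2', h3', h4', h5'⟩ := h'
      refine ⟨ψ + ψ', h1.add h1', h2.add h2', ?_, ?_, ?_⟩
      · exact (tsupport_add ψ ψ').trans (union_subset h3 h3')
      · have := Lp.coeFn_add p.fst p'.fst
        filter_upwards [this, h4, h4'] with x e1 e2 e3
        rw [WithLp.add_fst, e1, Pi.add_apply, Pi.add_apply, e2, e3]
      · have := Lp.coeFn_add p.snd p'.snd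
        filter_upwards [this, h5, h5'] with x e1 e2 e3
        rw [WithLp.add_snd, e1, Pi.add_apply, e2, e3, gradient, gradient, gradient, ← map_add,
          fderiv_add (h1.differentiable (by simp) x) (h1'.differentiable (by simp) x)]
    | smul c p _ h =>
      obtain ⟨ψ, h1, h2, h3, h4, h5⟩ := h
      refine ⟨c • ψ, h1.const_smul c, h2.smul_left (f := fun _ => c), ?_, ?_, ?_⟩
      · exact (tsupport_smul_subset_right (fun _ => c) ψ).trans h3
      · have := Lp.coeFn_smul c p.fst
        filter_upwards [this, h4] with x e1 e2
        rw [WithLp.smul_fst, e1, Pi.smul_apply, Pi.smul_apply, e2]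
      · have := Lp.coeFn_smul c p.snd
        filter_upwards [this, h5] with x e1 e2
        rw [WithLp.smul_snd, e1, Pi.smul_apply, e2, gradient, gradient,
          fderiv_const_smul (h1.differentiable (by simp) x)]
        simp
  have hsub : ((H10Sub Ω : Submodule ℝ _) : Set (WithLp 2 (L2 Ω × L2Vec Ω))) ⊆
      {p | ‖p.fst‖ ^ 2 ≤ 4 * R ^ 2 * ‖p.snd‖ ^ 2} := by
    refine closure_minimal (fun p hp => ?_) hclosed
    obtain ⟨ψ, h1, h2, h3, h4, h5⟩ := hspan p hp
    have hg : Function.support (gradient ψ) ⊆ Ω := by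
      intro x hx
      refine h3 (support_fderiv_subset ℝ ?_)
      intro h0
      exact hx (by simp [gradient, h0])
    have := integral_sq_le_of_bounded_support (R := R) i h1 h2 (fun x hx =>
      (PiLp.norm_apply_le x i).trans (hR x (h3 hx)))
    rw [mem_ofPred_eq, norm_sq_eq_integral_of_ae_eq h4 ((subset_tsupport ψ).trans h3),
      norm_sq_eq_integral_of_ae_eq h5 hg]
    simpa using this
  exact hsub (@Subtype.property _ (fun p => p ∈ H10Sub Ω) w)

theorem IsConvexPolytopeDomain.isBounded {d : ℕ} {Ω : Set (EuclideanSpace ℝ (Fin d))}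
    (hΩ : IsConvexPolytopeDomain Ω) : Bornology.IsBounded Ω := by
  obtain ⟨-, S, rfl⟩ := hΩ
  exact (isBounded_convexHull.2 S.finite_toSet.isBounded).subset interior_subset

/-! ### Orthonormal series in the dual of a Hilbert space -/

section Dual

variable {H : Type*} [NormedAddCommGroup H] [InnerProductSpace ℝ H] [CompleteSpace H]
  {e : ℕ → H}

theorem summable_smul_innerSL (he : Orthonormal ℝ e) {c : ℕ → ℝ}
    (hc : Summable fun j => c j ^ 2) : Summable fun j => c j • innerSL ℝ (e j) := by
  have h1 : Summable fun j => c j • e j := by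
    have := (he.orthogonalFamily.summable_iff_norm_sq_summable c).2 (by simpa using hc)
    simpa using this
  have h2 := h1.map (innerSL ℝ : H →L⋆[ℝ] H →L[ℝ] ℝ) (innerSL ℝ).continuous
  refine h2.congr fun j => ?_
  simp

theorem tsum_smul_innerSL_apply (he : Orthonormal ℝ e) {c : ℕ → ℝ}
    (hc : Summable fun j => c j ^ 2) (i : ℕ) : (∑' j, c j • innerSL ℝ (e j)) (e i) = c i := by
  have h := (summable_smul_innerSL he hc).hasSum.mapL (ContinuousLinearMap.apply ℝ ℝ (e i))
  have h1 : HasSum (fun j => ContinuousLinearMap.apply ℝ ℝ (e i) (c j • innerSL ℝ (e j))) (c i) := by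
    have : (fun j => ContinuousLinearMap.apply ℝ ℝ (e i) (c j • innerSL ℝ (e j))) =
        fun j => if j = i then c i else 0 := by
      funext j
      simp only [ContinuousLinearMap.apply_apply, smul_apply,
        innerSL_apply_apply, orthonormal_iff_ite.1 he j i]
      split_ifs with h
      · simp [h]
      · simp
    rw [this]
    exact hasSum_ite_eq i (c i)
  exact h.unique h1

theorem norm_sq_tsum_smul_innerSL (he : Orthonormal ℝ e) {c : ℕ → ℝ}
    (hc : Summable fun j => c j ^ 2) :
    ‖∑' j, c j • innerSL ℝ (e j)‖ ^ 2 = ∑' j, c j ^ 2 := by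
  have h := ((summable_smul_innerSL he hc).hasSum.norm.pow 2)
  refine tendsto_nhds_unique h ?_
  refine hc.hasSum.congr fun s => ?_
  have h1 : ∑ j ∈ s, c j • innerSL ℝ (e j) = innerSL ℝ (∑ j ∈ s, c j • e j) := by
    simp [map_sum]
  have h2 := he.orthogonalFamily.norm_sum c s
  simp only [LinearIsometry.toSpanSingleton_apply, Real.norm_eq_abs, sq_abs] at h2
  rw [h1, innerSL_apply_norm, h2]

/-- Restriction of functionals to the closed span of `e`, extended by zero. -/
def spanProj (e : ℕ → H) : StrongDual ℝ H →L[ℝ] StrongDual ℝ H :=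
  (ContinuousLinearMap.compL ℝ H H ℝ).flip
    (Submodule.span ℝ (range e)).topologicalClosure.starProjection

theorem spanProj_apply (e : ℕ → H) (v : StrongDual ℝ H) (h : H) :
    spanProj e v h = v ((Submodule.span ℝ (range e)).topologicalClosure.starProjection h) := rfl

theorem spanProj_innerSL (e : ℕ → H) (j : ℕ) : spanProj e (innerSL ℝ (e j)) = innerSL ℝ (e j) := by
  ext h
  rw [spanProj_apply, innerSL_apply_apply, innerSL_apply_apply,
    ← Submodule.inner_starProjection_left_eq_right, Submodule.starProjection_eq_self_iff.2]
  exact Submodule.le_topologicalClosure _ (Submodule.subset_span ⟨j, rfl⟩)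

/-- A functional fixed by `spanProj` factors through the orthogonal projection onto the closed span
of `e`, so its values on `e` determine it. -/
theorem eq_of_spanProj_eq_self {v w : StrongDual ℝ H} (hv : spanProj e v = v)
    (hw : spanProj e w = w) (h : ∀ j, v (e j) = w (e j)) : v = w := by
  have hle : (Submodule.span ℝ (range e)).topologicalClosure ≤ (v - w).ker := by
    refine Submodule.topologicalClosure_minimal _ (Submodule.span_le.2 ?_)
      (ContinuousLinearMap.isClosed_ker _)
    rintro _ ⟨j, rfl⟩
    simp [h j]
  ext x
  rw [← hv, ← hw, spanProj_apply, spanProj_apply]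
  have := hle (Submodule.starProjection_apply_mem _ x)
  simpa [sub_eq_zero] using this

end Dual

/-! ### Young's inequality in `L²` -/

/-- Cauchy–Schwarz for the splitting κν = κ^{1/2} · κ^{1/2}ν. -/
theorem lintegral_mul_sq_le {μ : Measure ℝ} {κ ν : ℝ → ℝ≥0∞} (hκ : AEMeasurable κ μ)
    (hν : AEMeasurable ν μ) :
    (∫⁻ s, κ s * ν s ∂μ) ^ 2 ≤ (∫⁻ s, κ s ∂μ) * ∫⁻ s, κ s * ν s ^ 2 ∂μ := by
  have hsq : ∀ x : ℝ≥0∞, x ^ (1 / 2 : ℝ) * x ^ (1 / 2 : ℝ) = x := fun x => by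
    rw [← ENNReal.rpow_add_of_nonneg _ _ (by norm_num) (by norm_num)]; norm_num
  have hsq2 : ∀ x : ℝ≥0∞, (x ^ (1 / 2 : ℝ)) ^ (2 : ℝ) = x := fun x => by
    rw [← ENNReal.rpow_mul]; norm_num
  have h := ENNReal.lintegral_mul_le_Lp_mul_Lq μ Real.HolderConjugate.two_two
    (f := fun s => κ s ^ (1 / 2 : ℝ)) (g := fun s => κ s ^ (1 / 2 : ℝ) * ν s)
    (by fun_prop) (by fun_prop)
  simp only [Pi.mul_apply, ← mul_assoc, hsq, ENNReal.mul_rpow_of_nonneg _ _ zero_le_two, hsq2] at h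
  calc (∫⁻ s, κ s * ν s ∂μ) ^ 2 ≤ _ := pow_le_pow_left₀ zero_le h 2
    _ = _ := by
      rw [mul_pow, ← ENNReal.rpow_two, ← ENNReal.rpow_two, hsq2, hsq2]
      simp only [ENNReal.rpow_two]

/-- Young's inequality for L¹ * L²: the weighted Cauchy–Schwarz bound is integrated in t, and
Tonelli with translation invariance does the rest. -/
theorem lintegral_sq_conv_le {κ ν : ℝ → ℝ≥0∞} (hκ : AEMeasurable κ) (hν : AEMeasurable ν) :
    ∫⁻ t, (∫⁻ s, κ (t - s) * ν s) ^ 2 ≤ (∫⁻ s, κ s) ^ 2 * ∫⁻ s, ν s ^ 2 := by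
  have hκ' : ∀ t : ℝ, AEMeasurable fun s => κ (t - s) := fun t =>
    hκ.comp_quasiMeasurePreserving (quasiMeasurePreserving_sub_left_of_right_invariant _ t)
  have h1 : ∀ t, (∫⁻ s, κ (t - s) * ν s) ^ 2 ≤
      (∫⁻ s, κ s) * ∫⁻ s, κ (t - s) * ν s ^ 2 := by
    intro t
    refine (lintegral_mul_sq_le (hκ' t) hν).trans (le_of_eq ?_)
    rw [lintegral_sub_left_eq_self]
  have hprod : AEMeasurable (Function.uncurry fun t s : ℝ => κ (t - s) * ν s ^ 2)
      (volume.prod volume) := by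
    have h2 : AEMeasurable (fun p : ℝ × ℝ => κ (p.1 - p.2)) (volume.prod volume) :=
      hκ.comp_quasiMeasurePreserving (quasiMeasurePreserving_sub_of_right_invariant _ _)
    exact h2.mul ((hν.comp_snd).pow_const 2)
  calc ∫⁻ t, (∫⁻ s, κ (t - s) * ν s) ^ 2
      ≤ ∫⁻ t, (∫⁻ s, κ s) * ∫⁻ s, κ (t - s) * ν s ^ 2 := lintegral_mono h1
    _ = (∫⁻ s, κ s) * ∫⁻ t, ∫⁻ s, κ (t - s) * ν s ^ 2 :=
        lintegral_const_mul'' _ hprod.lintegral_prod_right'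
    _ = (∫⁻ s, κ s) * ∫⁻ s, ∫⁻ t, κ (t - s) * ν s ^ 2 := by
        rw [lintegral_lintegral_swap hprod]
    _ = (∫⁻ s, κ s) * ∫⁻ s, (∫⁻ t, κ t) * ν s ^ 2 := by
        congr 1
        refine lintegral_congr fun s => ?_
        rw [lintegral_mul_const'', lintegral_sub_right_eq_self]
        exact hκ.comp_quasiMeasurePreserving
          (measurePreserving_sub_right volume s).quasiMeasurePreserving
    _ = _ := by
        rw [lintegral_const_mul'' _ (by fun_prop)]
        ring

theorem lintegral_vconv_sq_le {k v : ℝ → ℝ} {t A : ℝ} (hk : IntegrableOn k (Ioo 0 t))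
    (hk0 : ∀ s ∈ Ioo 0 t, 0 ≤ k s) (hA : ∫ s in Ioo 0 t, k s ≤ A)
    (hv : AEStronglyMeasurable v (volume.restrict (Ioo 0 t))) :
    ∫⁻ τ in Ioo 0 t, ENNReal.ofReal (vconv k v τ ^ 2) ≤
      ENNReal.ofReal A ^ 2 * ∫⁻ τ in Ioo 0 t, ENNReal.ofReal (v τ ^ 2) := by
  let κ : ℝ → ℝ≥0∞ := fun s => ‖(Ioo 0 t).indicator k s‖ₑ
  let ν : ℝ → ℝ≥0∞ := fun s => ‖(Ioo 0 t).indicator v s‖ₑ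
  have hκ : AEMeasurable κ :=
    ((integrable_indicator_iff measurableSet_Ioo).2 hk).1.enorm
  have hν : AEMeasurable ν :=
    ((aestronglyMeasurable_indicator_iff measurableSet_Ioo).2 hv).enorm
  have hofReal : ∀ y : ℝ, ENNReal.ofReal (y ^ 2) = ‖y‖ₑ ^ 2 := fun y => by
    rw [← sq_abs, ENNReal.ofReal_pow (abs_nonneg _), Real.enorm_eq_ofReal_abs]
  have h1 : ∫⁻ τ in Ioo 0 t, ENNReal.ofReal (vconv k v τ ^ 2) ≤
      ∫⁻ τ, (∫⁻ s, κ (τ - s) * ν s) ^ 2 := by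
    refine (setLIntegral_mono' measurableSet_Ioo fun τ hτ => ?_).trans (setLIntegral_le_lintegral _ _)
    rw [hofReal, vconv_eq_convolution k v hτ.2.le, convolution_eq_swap]
    refine pow_le_pow_left₀ zero_le ((enorm_integral_le_lintegral_enorm _).trans (le_of_eq ?_)) 2
    refine lintegral_congr fun s => ?_
    rw [ContinuousLinearMap.lsmul_apply, enorm_smul]
  have h2 : ∫⁻ s, κ s ≤ ENNReal.ofReal A := by
    have : κ = (Ioo 0 t).indicator fun s => ‖k s‖ₑ := by
      funext s; exact enorm_indicator_eq_indicator_enorm _ _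
    rw [this, lintegral_indicator measurableSet_Ioo]
    refine le_trans (le_of_eq ?_) (ENNReal.ofReal_le_ofReal hA)
    rw [ofReal_integral_eq_lintegral_ofReal hk
      ((ae_restrict_iff' measurableSet_Ioo).2 (Filter.Eventually.of_forall hk0))]
    refine setLIntegral_congr_fun measurableSet_Ioo fun s hs => ?_
    rw [Real.enorm_eq_ofReal (hk0 s hs)]
  have h3 : ∫⁻ s, ν s ^ 2 = ∫⁻ τ in Ioo 0 t, ENNReal.ofReal (v τ ^ 2) := by
    rw [← lintegral_indicator measurableSet_Ioo]
    refine lintegral_congr fun s => ?_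
    by_cases hs : s ∈ Ioo 0 t
    · simp only [ν, indicator_of_mem hs, hofReal]
    · simp only [ν, indicator_of_notMem hs]; simp
  calc _ ≤ _ := h1
    _ ≤ _ := lintegral_sq_conv_le hκ hν
    _ ≤ _ := by rw [h3]; gcongr

/-! ### Series of eigenfunctions in `H⁻¹(Ω)` -/

section Eigen

variable {d : ℕ} {Ω : Set (EuclideanSpace ℝ (Fin d))} {lam : ℕ → ℝ} {φ : ℕ → H10 Ω}

instance : CompleteSpace (H10 Ω) :=
  (Submodule.isClosed_topologicalClosure _).completeSpace_coe

theorem H10.inner_eq (v w : H10 Ω) :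
    inner ℝ v w = inner ℝ v.val w.val + inner ℝ v.grad w.grad := rfl

theorem ofL2_apply (g : L2 Ω) (w : H10 Ω) : ofL2 g w = inner ℝ g w.val := rfl

theorem IsDirichletEigensystem.inner_left (hφ : IsDirichletEigensystem Ω lam φ) (j : ℕ)
    (w : H10 Ω) : inner ℝ (φ j) w = (1 + lam j) * inner ℝ (φ j).val w.val := by
  rw [H10.inner_eq, hφ.eigen j w]; ring

theorem IsDirichletEigensystem.eigenvalue_eq (hφ : IsDirichletEigensystem Ω lam φ) (j : ℕ) :
    lam j = ‖(φ j).grad‖ ^ 2 := by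
  have h := hφ.eigen j (φ j)
  rw [real_inner_self_eq_norm_sq, real_inner_self_eq_norm_sq, hφ.orthonormal.1 j] at h
  rw [h]; ring

theorem IsDirichletEigensystem.eigenvalue_nonneg (hφ : IsDirichletEigensystem Ω lam φ) (j : ℕ) :
    0 ≤ lam j := by rw [hφ.eigenvalue_eq j]; positivity

theorem IsDirichletEigensystem.exists_le_eigenvalue (hφ : IsDirichletEigensystem Ω lam φ)
    (hd : 1 ≤ d) (hΩ : Bornology.IsBounded Ω) : ∃ c > 0, ∀ j, c ≤ lam j := by
  obtain ⟨C, hC, h⟩ := exists_poincare hd hΩ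
  refine ⟨C⁻¹, inv_pos.2 hC, fun j => ?_⟩
  have := h (φ j)
  rw [hφ.orthonormal.1 j, ← hφ.eigenvalue_eq j] at this
  rw [inv_le_iff_one_le_mul₀ hC]
  linarith

/-- The eigenfunctions, normalized in `H¹₀(Ω)`. -/
def normEigen (lam : ℕ → ℝ) (φ : ℕ → H10 Ω) (j : ℕ) : H10 Ω := (√(1 + lam j))⁻¹ • φ j

theorem IsDirichletEigensystem.orthonormal_normEigen (hφ : IsDirichletEigensystem Ω lam φ) :
    Orthonormal ℝ (normEigen lam φ) := by
  rw [orthonormal_iff_ite]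
  intro i j
  have h1 : 0 < 1 + lam i := by linarith [hφ.eigenvalue_nonneg i]
  rw [normEigen, normEigen, real_inner_smul_left, real_inner_smul_right, hφ.inner_left,
    orthonormal_iff_ite.1 hφ.orthonormal i j]
  split_ifs with h
  · subst h
    have h3 : 0 < √(1 + lam i) := Real.sqrt_pos.2 h1
    field_simp
    rw [Real.sq_sqrt h1.le]
  · simp

/-- By the weak eigenvalue equation, the H¹ pairing with φ_j is 1 + λ_j times the L² pairing.
Eigenfunction series in H⁻¹ are therefore orthonormal series, with squared norm ∑ c_j²/(1 + λ_j). -/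
theorem IsDirichletEigensystem.ofL2_eq (hφ : IsDirichletEigensystem Ω lam φ) (j : ℕ) :
    ofL2 (φ j).val = (√(1 + lam j))⁻¹ • innerSL ℝ (normEigen lam φ j) := by
  have h1 : 0 < 1 + lam j := by linarith [hφ.eigenvalue_nonneg j]
  ext w
  rw [ofL2_apply, smul_apply, innerSL_apply_apply, normEigen,
    real_inner_smul_left, hφ.inner_left, smul_eq_mul, ← mul_assoc, ← mul_assoc, ← mul_inv,
    Real.mul_self_sqrt h1.le, inv_mul_cancel₀ h1.ne', one_mul]

/-- The series `∑ⱼ cⱼ φⱼ` in `H⁻¹(Ω)`. -/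
def synth (φ : ℕ → H10 Ω) (c : ℕ → ℝ) : Hneg1 Ω := ∑' j, c j • ofL2 (φ j).val

theorem IsDirichletEigensystem.smul_ofL2_eq (hφ : IsDirichletEigensystem Ω lam φ) (c : ℕ → ℝ)
    (j : ℕ) : c j • ofL2 (φ j).val =
      (c j * (√(1 + lam j))⁻¹) • innerSL ℝ (normEigen lam φ j) := by
  rw [hφ.ofL2_eq, smul_smul]

theorem IsDirichletEigensystem.coef_sq (hφ : IsDirichletEigensystem Ω lam φ) (c : ℕ → ℝ)
    (j : ℕ) : (c j * (√(1 + lam j))⁻¹) ^ 2 = c j ^ 2 / (1 + lam j) := by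
  have h1 : 0 ≤ 1 + lam j := by linarith [hφ.eigenvalue_nonneg j]
  rw [mul_pow, inv_pow, Real.sq_sqrt h1]; rfl

theorem IsDirichletEigensystem.summable_synth (hφ : IsDirichletEigensystem Ω lam φ) {c : ℕ → ℝ}
    (hc : Summable fun j => c j ^ 2 / (1 + lam j)) :
    Summable fun j => c j • ofL2 (φ j).val := by
  simp only [hφ.smul_ofL2_eq c]
  exact summable_smul_innerSL hφ.orthonormal_normEigen (by simpa only [hφ.coef_sq] using hc)

theorem IsDirichletEigensystem.norm_sq_synth (hφ : IsDirichletEigensystem Ω lam φ) {c : ℕ → ℝ}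
    (hc : Summable fun j => c j ^ 2 / (1 + lam j)) :
    ‖synth φ c‖ ^ 2 = ∑' j, c j ^ 2 / (1 + lam j) := by
  simp only [synth, hφ.smul_ofL2_eq c]
  rw [norm_sq_tsum_smul_innerSL hφ.orthonormal_normEigen (by simpa only [hφ.coef_sq] using hc)]
  simp only [hφ.coef_sq]

theorem IsDirichletEigensystem.synth_apply (hφ : IsDirichletEigensystem Ω lam φ) {c : ℕ → ℝ}
    (hc : Summable fun j => c j ^ 2 / (1 + lam j)) (i : ℕ) : synth φ c (φ i) = c i := by
  have h1 : 0 < √(1 + lam i) := Real.sqrt_pos.2 (by linarith [hφ.eigenvalue_nonneg i])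
  have h2 : φ i = √(1 + lam i) • normEigen lam φ i := by
    rw [normEigen, smul_smul, mul_inv_cancel₀ h1.ne', one_smul]
  rw [h2, map_smul]
  simp only [synth, hφ.smul_ofL2_eq c]
  rw [tsum_smul_innerSL_apply hφ.orthonormal_normEigen (by simpa only [hφ.coef_sq] using hc)]
  rw [smul_eq_mul]; field_simp

theorem IsDirichletEigensystem.spanProj_synth (hφ : IsDirichletEigensystem Ω lam φ) {c : ℕ → ℝ}
    (hc : Summable fun j => c j ^ 2 / (1 + lam j)) :
    spanProj (normEigen lam φ) (synth φ c) = synth φ c := by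
  rw [synth, ContinuousLinearMap.map_tsum _ (hφ.summable_synth hc)]
  refine tsum_congr fun j => ?_
  rw [hφ.smul_ofL2_eq, map_smul, spanProj_innerSL]

theorem eq_of_spanProj_normEigen {v w : Hneg1 Ω} (hv : spanProj (normEigen lam φ) v = v)
    (hw : spanProj (normEigen lam φ) w = w) (h : ∀ j, v (φ j) = w (φ j)) : v = w :=
  eq_of_spanProj_eq_self hv hw fun j => by rw [normEigen, map_smul, map_smul, h j]

theorem IsDirichletEigensystem.summable_of_abs_le (hφ : IsDirichletEigensystem Ω lam φ)
    {c e : ℕ → ℝ} {A : ℝ} (he : Summable fun j => e j ^ 2 / (1 + lam j))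
    (h : ∀ j, |c j| ≤ A * |e j|) :
    Summable (fun j => c j ^ 2 / (1 + lam j)) ∧
      ∑' j, c j ^ 2 / (1 + lam j) ≤ A ^ 2 * ∑' j, e j ^ 2 / (1 + lam j) := by
  have h1 : ∀ j, 0 < 1 + lam j := fun j => by linarith [hφ.eigenvalue_nonneg j]
  have h2 : ∀ j, c j ^ 2 / (1 + lam j) ≤ A ^ 2 * (e j ^ 2 / (1 + lam j)) := fun j => by
    have h3 : c j ^ 2 ≤ A ^ 2 * e j ^ 2 := by
      rw [← sq_abs (c j), ← sq_abs (e j), ← mul_pow]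
      exact pow_le_pow_left₀ (abs_nonneg _) (h j) 2
    rw [← mul_div_assoc]
    exact div_le_div_of_nonneg_right h3 (h1 j).le
  have h3 := he.mul_left (A ^ 2)
  have h4 : Summable fun j => c j ^ 2 / (1 + lam j) :=
    Summable.of_nonneg_of_le (fun j => div_nonneg (sq_nonneg _) (h1 j).le) h2 h3
  refine ⟨h4, ?_⟩
  rw [← tsum_mul_left]
  exact h4.tsum_le_tsum h2 h3

theorem IsDirichletEigensystem.norm_synth_le (hφ : IsDirichletEigensystem Ω lam φ)
    {c e : ℕ → ℝ} {A : ℝ} (hA : 0 ≤ A) (he : Summable fun j => e j ^ 2 / (1 + lam j))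
    (h : ∀ j, |c j| ≤ A * |e j|) : ‖synth φ c‖ ≤ A * ‖synth φ e‖ := by
  obtain ⟨h1, h2⟩ := hφ.summable_of_abs_le he h
  refine le_of_sq_le_sq ?_ (by positivity)
  rwa [hφ.norm_sq_synth h1, mul_pow, hφ.norm_sq_synth he]

theorem aestronglyMeasurable_synth {μ : Measure ℝ} {c : ℝ → ℕ → ℝ}
    (hc : ∀ j, AEStronglyMeasurable (fun t => c t j) μ)
    (hs : ∀ᵐ t ∂μ, Summable fun j => c t j • ofL2 (φ j).val) :
    AEStronglyMeasurable (fun t => synth φ (c t)) μ := by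
  refine aestronglyMeasurable_of_tendsto_ae Filter.atTop
    (f := fun n t => ∑ j ∈ Finset.range n, c t j • ofL2 (φ j).val) (fun n => ?_) ?_
  · exact Finset.aestronglyMeasurable_fun_sum _ fun j _ => (hc j).smul_const _
  · filter_upwards [hs] with t ht
    exact ht.hasSum.tendsto_sum_nat

/-- The constant of the embedding of `Ḣ^q(Ω)` in `H⁻¹(Ω)`. -/
theorem inv_one_add_le_rpow {c x q : ℝ} (hc : 0 < c) (hx : c ≤ x) (hq : -1 < q) :
    (1 + x)⁻¹ ≤ (c ^ (q + 1))⁻¹ * x ^ q := by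
  have hx0 : 0 < x := hc.trans_le hx
  have h1 : c ^ (q + 1) ≤ x ^ (q + 1) := Real.rpow_le_rpow hc.le hx (by linarith)
  have h2 : 0 < c ^ (q + 1) := Real.rpow_pos_of_pos hc _
  have h3 : 0 < x ^ q := Real.rpow_pos_of_pos hx0 _
  rw [Real.rpow_add_one hx0.ne'] at h1
  rw [inv_mul_eq_div, inv_eq_one_div, div_le_div_iff₀ (by positivity) h2]
  nlinarith

/-- The weight 1/(1 + λ_j) is at most a multiple of λ_j^q, so the series lies in L²(0,T;H⁻¹). On a
bounded interval this gives Bochner integrability. -/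
theorem IsDirichletEigensystem.ae_summable_and_integrableOn_synth
    (hφ : IsDirichletEigensystem Ω lam φ) {c₀ q T : ℝ} (hc₀ : 0 < c₀) (hlam : ∀ j, c₀ ≤ lam j)
    (hq : -1 < q) {c : ℝ → ℕ → ℝ}
    (hc : ∀ j, AEStronglyMeasurable (fun t => c t j) (volume.restrict (Ioo 0 T)))
    (hfin : ∫⁻ t in Ioo 0 T, ∑' j, ENNReal.ofReal (lam j ^ q * c t j ^ 2) < ⊤) :
    (∀ᵐ t ∂(volume.restrict (Ioo 0 T)), Summable fun j => c t j ^ 2 / (1 + lam j)) ∧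
      IntegrableOn (fun t => synth φ (c t)) (Ioo 0 T) := by
  let M := (c₀ ^ (q + 1))⁻¹
  have hM : 0 ≤ M := by positivity
  have hpos : ∀ j, 0 < lam j := fun j => hc₀.trans_le (hlam j)
  have hterm : ∀ t j, 0 ≤ lam j ^ q * c t j ^ 2 := fun t j =>
    mul_nonneg (Real.rpow_nonneg (hpos j).le _) (sq_nonneg _)
  have hle : ∀ t j, c t j ^ 2 / (1 + lam j) ≤ M * (lam j ^ q * c t j ^ 2) := fun t j => by
    have := mul_le_mul_of_nonneg_right (inv_one_add_le_rpow hc₀ (hlam j) hq) (sq_nonneg (c t j))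
    rw [div_eq_inv_mul]
    linarith
  have hmeas : ∀ j, AEMeasurable (fun t => ENNReal.ofReal (lam j ^ q * c t j ^ 2))
      (volume.restrict (Ioo 0 T)) := fun j =>
    ((hc j).aemeasurable.pow_const 2 |>.const_mul _).ennreal_ofReal
  have hsum : ∀ᵐ t ∂(volume.restrict (Ioo 0 T)), Summable (fun j => lam j ^ q * c t j ^ 2) := by
    filter_upwards [ae_lt_top' (AEMeasurable.tsum hmeas) hfin.ne] with t ht
    have := ENNReal.summable_toReal ht.ne
    refine this.congr fun j => ENNReal.toReal_ofReal (hterm t j)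
  have hS : ∀ᵐ t ∂(volume.restrict (Ioo 0 T)), Summable fun j => c t j ^ 2 / (1 + lam j) := by
    filter_upwards [hsum] with t ht
    exact Summable.of_nonneg_of_le (fun j => div_nonneg (sq_nonneg _) (by linarith [hpos j]))
      (hle t) (ht.mul_left M)
  refine ⟨hS, ?_⟩
  have hmeasF := aestronglyMeasurable_synth (φ := φ) hc
    (hS.mono fun t ht => hφ.summable_synth ht)
  have hL2 : MemLp (fun t => synth φ (c t)) 2 (volume.restrict (Ioo 0 T)) := by
    refine ⟨hmeasF, ?_⟩
    rw [eLpNorm_lt_top_iff_lintegral_rpow_enorm_lt_top (by norm_num) (by norm_num)]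
    refine lt_of_le_of_lt (b := ∫⁻ t in Ioo 0 T, ENNReal.ofReal M *
      ∑' j, ENNReal.ofReal (lam j ^ q * c t j ^ 2)) (lintegral_mono_ae ?_) ?_
    · filter_upwards [hS, hsum] with t h1 h2
      simp only [ENNReal.toReal_ofNat, ENNReal.rpow_ofNat]
      rw [← ofReal_norm, ← ENNReal.ofReal_pow (norm_nonneg _), hφ.norm_sq_synth h1,
        ← ENNReal.ofReal_tsum_of_nonneg (hterm t) h2, ← ENNReal.ofReal_mul hM]
      refine ENNReal.ofReal_le_ofReal ?_
      rw [← tsum_mul_left]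
      exact h1.tsum_le_tsum (hle t) (h2.mul_left M)
    · rw [lintegral_const_mul'' _ (AEMeasurable.tsum hmeas)]
      exact ENNReal.mul_lt_top ENNReal.ofReal_lt_top hfin
  exact hL2.integrable (by norm_num)

end Eigen

/-! ### Fractional derivatives of convolutions -/

section Caputo

variable {X : Type*} [NormedAddCommGroup X] [NormedSpace ℝ X]

theorem vconv_sum_right {ι : Type*} (I : Finset ι) (c : ι → ℝ) {k : ℝ → ℝ} {v : ι → ℝ → X} {t : ℝ}
    (hv : ∀ i ∈ I, IntegrableOn (fun s => k (t - s) • v i s) (Ioo 0 t)) :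
    IntegrableOn (fun s => k (t - s) • ∑ i ∈ I, c i • v i s) (Ioo 0 t) ∧
      vconv k (fun s => ∑ i ∈ I, c i • v i s) t = ∑ i ∈ I, c i • vconv k (v i) t := by
  simp only [vconv, Finset.smul_sum, smul_comm (k _) (c _)]
  refine ⟨integrable_finsetSum _ fun i hi => (hv i hi).smul (c i), ?_⟩
  rw [integral_finsetSum]
  · simp only [integral_smul]
  · exact fun i hi => (hv i hi).smul (c i)

theorem hasCaputoDeriv_of_vconv {β T : ℝ} (hβ1 : β < 1) {u g : ℝ → X}
    (hu : IntegrableOn u (Ioo 0 T)) (hg : IntegrableOn g (Ioo 0 T))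
    (h : ∀ᵐ t ∂(volume.restrict (Ioo 0 T)),
      vconv (fracKer (1 - β)) u t = vconv (fracKer 1) g t) : HasCaputoDeriv β T u g := by
  have hk : IntegrableOn (fun t : ℝ => t ^ (-β)) (Ioo 0 T) := by
    have := integrableOn_rpow_Ioo (show 0 < 1 - β by linarith) T
    simpa using this
  refine ⟨hu, hg, ?_⟩
  filter_upwards [h, ae_integrableOn_vconv hk hu] with t h1 h2
  refine ⟨h2, ?_⟩
  have h3 : vconv (fracKer 1) g t = ∫ τ in Ioo 0 t, g τ := by simp [vconv, fracKer_one]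
  rw [← h3, ← h1, vconv, ← integral_smul]
  refine integral_congr_ae (Filter.Eventually.of_forall fun τ => ?_)
  simp only [fracKer, smul_smul]
  rw [show 1 - β - 1 = -β by ring, div_eq_inv_mul]

theorem ae_vconv_mlKer_add [CompleteSpace X] {ι : Type*} [Fintype ι] {β w : ι → ℝ}
    (hβ : ∀ i, 0 < β i) {x γ T : ℝ} (hx : 0 < x) (hγ : 0 < γ) {G : ℝ → X}
    (hG : IntegrableOn G (Ioo 0 T)) :
    ∀ᵐ t ∂(volume.restrict (Ioo 0 T)), vconv (mlKer β w (x + γ)) G t =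
      vconv (fracKer γ) (vconv (mlKer β w x) G) t := by
  have h1 : mlKer β w (x + γ) =ᵐ[volume.restrict (Ioo 0 T)]
      vconv (fracKer γ) (mlKer β w x) := by
    filter_upwards [self_mem_ae_restrict measurableSet_Ioo] with t ht
    rw [vconv_fracKer_mlKer hβ hx hγ ht.1]
  filter_upwards [self_mem_ae_restrict measurableSet_Ioo,
    vconv_assoc (integrableOn_fracKer hγ T) (integrableOn_mlKer (w := w) hβ hx T) hG] with t ht h2
  rw [vconv_congr h1 (Filter.EventuallyEq.refl _ _) ht.2.le, h2]

variable {m : ℕ} {α : ℝ} {a b : Fin m → ℝ}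

/-- Convolution with the kernel for `μ = 0` inverts `P(∂ₜ)`. -/
theorem hasMultiTermDeriv_vconv [CompleteSpace X] (hα0 : 0 < α) (hα1 : α < 1)
    (ha : ∀ i, 0 < a i ∧ a i < α) {T : ℝ} {u G : ℝ → X} (hG : IntegrableOn G (Ioo 0 T))
    (hu : u =ᵐ[volume.restrict (Ioo 0 T)]
      vconv (mlKer (multiExp α a) (multiCoef b 0) α) G) :
    HasMultiTermDeriv α a b T u G := by
  have hβ := multiExp_pos hα0 ha
  set K : ℝ → ℝ → ℝ := mlKer (multiExp α a) (multiCoef b 0) with hK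
  have hKint : ∀ x, 0 < x → IntegrableOn (K x) (Ioo 0 T) := fun x hx =>
    integrableOn_mlKer hβ hx T
  have hpos : ∀ i, 0 < α - a i := fun i => sub_pos.2 (ha i).2
  have hui : IntegrableOn u (Ioo 0 T) :=
    (integrableOn_vconv (hKint α hα0) hG).congr hu.symm
  -- Lowering the index from α by αᵢ multiplies the transform by z^{αᵢ}, so this is the derivative
  -- of order αᵢ.
  let gs : Fin m → ℝ → X := fun i => vconv (K (α - a i)) G
  have hgs : ∀ i, IntegrableOn (gs i) (Ioo 0 T) := fun i =>
    integrableOn_vconv (hKint _ (hpos i)) hG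
  have hfrac : ∀ β, β < 1 → ∀ᵐ t ∂(volume.restrict (Ioo 0 T)),
      vconv (fracKer (1 - β)) u t = vconv (K (α + (1 - β))) G t := by
    intro β hβ1
    filter_upwards [self_mem_ae_restrict measurableSet_Ioo,
      ae_vconv_mlKer_add (w := multiCoef b 0) hβ hα0 (sub_pos.2 hβ1) hG] with t ht h
    rw [vconv_congr (Filter.EventuallyEq.refl _ _) hu ht.2.le, ← h]
  have hgs1 : ∀ i, ∀ᵐ t ∂(volume.restrict (Ioo 0 T)),
      vconv (K (α + (1 - a i))) G t = vconv (fracKer 1) (gs i) t := by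
    intro i
    filter_upwards [ae_vconv_mlKer_add (w := multiCoef b 0) hβ (hpos i) one_pos hG] with t h
    rw [show α + (1 - a i) = α - a i + 1 by ring]
    exact h
  have hsumint : IntegrableOn (fun t => ∑ i, b i • gs i t) (Ioo 0 T) :=
    integrable_finsetSum _ fun i _ => (hgs i).smul (b i)
  -- The leading derivative is what the lower-order terms leave of G. That it has the right
  -- primitive is the recursion at index 1 with μ = 0, convolved with G.
  refine ⟨fun t => G t - ∑ i, b i • gs i t, gs, ?_, fun i => ?_, ?_⟩
  · refine hasCaputoDeriv_of_vconv hα1 hui (hG.sub hsumint) ?_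
    filter_upwards [hfrac α hα1, ae_vconv_mlKer_expand (w := multiCoef b 0) hβ one_pos hG,
      ae_all_iff.2 hgs1, ae_integrableOn_vconv (integrableOn_fracKer one_pos T) hG,
      ae_all_iff.2 fun i => ae_integrableOn_vconv (integrableOn_fracKer one_pos T) (hgs i)]
      with t h1 h2 h3 h4 h5
    obtain ⟨h6, h7⟩ := vconv_sum_right Finset.univ b (k := fracKer 1) (v := gs) fun i _ => h5 i
    rw [h1, show α + (1 - α) = 1 by ring, hK, h2, vconv_sub_right h4 h6, h7, Fin.sum_univ_succ,
      sub_eq_add_neg, ← Finset.sum_neg_distrib]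
    congr 1
    have e0 : multiCoef b 0 0 = 0 := by simp [multiCoef]
    rw [e0, zero_smul, zero_add]
    refine Finset.sum_congr rfl fun i _ => ?_
    have e1 : multiCoef b 0 i.succ = -b i := rfl
    have e2 : multiExp α a i.succ = α - a i := rfl
    rw [e1, e2, ← h3 i, neg_smul, show 1 + (α - a i) = α + (1 - a i) by ring]
  · have hai : a i < 1 := (ha i).2.trans hα1
    refine hasCaputoDeriv_of_vconv hai hui (hgs i) ?_
    filter_upwards [hfrac (a i) hai, hgs1 i] with t h1 h2
    rw [h1, h2]
  · exact Filter.Eventually.of_forall fun t => by simp [gs]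

/-- The scalar solution formula, rewritten with the kernel for `μ = 0`. -/
theorem ae_vconv_multiKer_eq [CompleteSpace X] (hα0 : 0 < α) (ha : ∀ i, 0 < a i ∧ a i < α)
    (μ : ℝ) {T : ℝ} {v : ℝ → X} (hv : IntegrableOn v (Ioo 0 T)) :
    ∀ᵐ t ∂(volume.restrict (Ioo 0 T)),
      vconv (mlKer (multiExp α a) (multiCoef b 0) α)
        (fun s => v s - μ • vconv (mlKer (multiExp α a) (multiCoef b μ) α) v s) t =
      vconv (mlKer (multiExp α a) (multiCoef b μ) α) v t := by
  have hβ := multiExp_pos hα0 ha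
  have hk : ∀ μ, IntegrableOn (mlKer (multiExp α a) (multiCoef b μ) α) (Ioo 0 T) := fun μ =>
    integrableOn_mlKer hβ hα0 T
  have hkk := integrableOn_vconv (hk 0) (hk μ)
  have hkv := integrableOn_vconv (hk μ) hv
  -- K_0 = K_μ + μ K_0 * K_μ. After convolution with v and reassociation, the second part cancels
  -- the correction in the argument of K_0.
  have h0 : mlKer (multiExp α a) (multiCoef b 0) α =ᵐ[volume.restrict (Ioo 0 T)]
      fun t => mlKer (multiExp α a) (multiCoef b μ) α t +
        μ * vconv (mlKer (multiExp α a) (multiCoef b 0) α)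
          (mlKer (multiExp α a) (multiCoef b μ) α) t := by
    filter_upwards [ae_multiKer_resolvent (b := b) hα0 ha μ T] with t h
    linarith
  filter_upwards [self_mem_ae_restrict measurableSet_Ioo, vconv_assoc (hk 0) (hk μ) hv,
    ae_integrableOn_vconv (hk 0) hv, ae_integrableOn_vconv (hk μ) hv,
    ae_integrableOn_vconv (hk 0) (hkv.smul μ), ae_integrableOn_vconv (hkk.const_mul μ) hv]
    with t ht h1 h2 h3 h4 h5
  have h6 := vconv_sub_right h2 h4
  have h7 := vconv_smul_right μ (mlKer (multiExp α a) (multiCoef b 0) α)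
    (vconv (mlKer (multiExp α a) (multiCoef b μ) α) v) t
  refine h6.trans ?_
  change _ - vconv _ (fun s => μ • vconv (mlKer (multiExp α a) (multiCoef b μ) α) v s) t = _
  rw [h7, ← h1, vconv_congr h0 (Filter.EventuallyEq.refl _ v) ht.2.le,
    vconv_add_left h3 h5, vconv_smul_left]
  abel

end Caputo

/-! ### The solution operator -/

section Solution

variable {d m : ℕ} {Ω : Set (EuclideanSpace ℝ (Fin d))} {lam : ℕ → ℝ} {φ : ℕ → H10 Ω}
  {α : ℝ} {a b : Fin m → ℝ}

theorem ae_comp_sub_left {p : ℝ → Prop} {t T : ℝ} (ht : t ≤ T)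
    (h : ∀ᵐ r ∂(volume.restrict (Ioo 0 T)), p r) :
    ∀ᵐ s ∂(volume.restrict (Ioo 0 t)), p (t - s) := by
  have h1 := (ae_restrict_iff' measurableSet_Ioo).1 h
  have h2 := (quasiMeasurePreserving_sub_left_of_right_invariant (volume : Measure ℝ) t).ae h1
  rw [ae_restrict_iff' measurableSet_Ioo]
  filter_upwards [h2] with s hs hs'
  exact hs ⟨by linarith [hs'.2], by linarith [hs'.1]⟩

/-- The coefficients of the solution. -/
def solCoef (lam : ℕ → ℝ) (φ : ℕ → H10 Ω) (α : ℝ) (a b : Fin m → ℝ) (f : ℝ → Hneg1 Ω)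
    (j : ℕ) : ℝ → ℝ :=
  vconv (mlKer (multiExp α a) (multiCoef b (lam j)) α) fun s => f s (φ j)

/-- Young's inequality for the nonnegative kernel λ_j K_{λ_j}, whose mass on (0, t) is at most 1
whatever j and t are. -/
theorem lintegral_solCoef_le (hφ : IsDirichletEigensystem Ω lam φ) (hα0 : 0 < α) (hα1 : α < 1)
    (ha : ∀ i, 0 < a i ∧ a i < α) (hb : ∀ i, 0 < b i) {t : ℝ} (ht : 0 < t) {f : ℝ → Hneg1 Ω}
    (hf : AEStronglyMeasurable f (volume.restrict (Ioo 0 t))) (j : ℕ) :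
    ∫⁻ τ in Ioo 0 t, ENNReal.ofReal ((lam j * solCoef lam φ α a b f j τ) ^ 2) ≤
      ∫⁻ τ in Ioo 0 t, ENNReal.ofReal (f τ (φ j) ^ 2) := by
  have hl := hφ.eigenvalue_nonneg j
  have hfj : AEStronglyMeasurable (fun τ => f τ (φ j)) (volume.restrict (Ioo 0 t)) :=
    (ContinuousLinearMap.apply ℝ ℝ (φ j)).continuous.comp_aestronglyMeasurable hf
  have h := lintegral_vconv_sq_le (A := 1)
    (k := fun s => lam j * mlKer (multiExp α a) (multiCoef b (lam j)) α s)
    ((integrableOn_mlKer (multiExp_pos hα0 ha) hα0 t).const_mul _)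
    (fun s hs => mul_nonneg hl (multiKer_pos hα0 hα1 ha hb hl hs.1).le)
    (by rw [integral_const_mul]; exact mul_setIntegral_multiKer_le hα0 hα1 ha hb hl ht) hfj
  simp only [vconv_smul_left, smul_eq_mul, ENNReal.ofReal_one, one_pow, one_mul] at h
  exact h

theorem lintegral_tsum_weighted_le (hφ : IsDirichletEigensystem Ω lam φ) (q : ℝ) {t : ℝ}
    {c e : ℕ → ℝ → ℝ} (hc : ∀ j, AEMeasurable (c j) (volume.restrict (Ioo 0 t)))
    (he : ∀ j, AEMeasurable (e j) (volume.restrict (Ioo 0 t)))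
    (h : ∀ j, ∫⁻ τ in Ioo 0 t, ENNReal.ofReal (c j τ ^ 2) ≤
      ∫⁻ τ in Ioo 0 t, ENNReal.ofReal (e j τ ^ 2)) :
    ∫⁻ τ in Ioo 0 t, ∑' j, ENNReal.ofReal (lam j ^ q * c j τ ^ 2) ≤
      ∫⁻ τ in Ioo 0 t, ∑' j, ENNReal.ofReal (lam j ^ q * e j τ ^ 2) := by
  have hl : ∀ j, 0 ≤ lam j ^ q := fun j => Real.rpow_nonneg (hφ.eigenvalue_nonneg j) _
  rw [lintegral_tsum fun j => ((hc j).pow_const 2 |>.const_mul _).ennreal_ofReal,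
    lintegral_tsum fun j => ((he j).pow_const 2 |>.const_mul _).ennreal_ofReal]
  refine ENNReal.tsum_le_tsum fun j => ?_
  simp only [ENNReal.ofReal_mul (hl j)]
  rw [lintegral_const_mul'' _ ((hc j).pow_const 2).ennreal_ofReal,
    lintegral_const_mul'' _ ((he j).pow_const 2).ennreal_ofReal]
  exact mul_le_mul' le_rfl (h j)

/-- As |K_{λ_j}| ≤ K_0, the H⁻¹ norm of the integrand is at most K_0(t − s) times that of ∑ ⟨f(s),
φ_j⟩ φ_j. This majorant is integrable in s for a.e. t, being the integrand of a convolution of two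
L¹ functions. -/
theorem ae_Ebar_convergence (hφ : IsDirichletEigensystem Ω lam φ) (hα0 : 0 < α) (hα1 : α < 1)
    (ha : ∀ i, 0 < a i ∧ a i < α) (hb : ∀ i, 0 < b i) {T : ℝ} {f : ℝ → Hneg1 Ω}
    (hf : AEStronglyMeasurable f (volume.restrict (Ioo 0 T)))
    (hfs : ∀ᵐ s ∂(volume.restrict (Ioo 0 T)), Summable fun j => f s (φ j) ^ 2 / (1 + lam j))
    (hF : IntegrableOn (fun s => synth φ fun j => f s (φ j)) (Ioo 0 T)) :
    ∀ᵐ t ∂(volume.restrict (Ioo 0 T)),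
      (∀ᵐ s ∂(volume.restrict (Ioo 0 t)),
        Summable (fun j => (kernelE α a b (lam j) (t - s) * f s (φ j)) ^ 2 / (1 + lam j))) ∧
      IntegrableOn (fun s => Ebar lam φ α a b (t - s) (f s)) (Ioo 0 t) := by
  have hβ := multiExp_pos hα0 ha
  have hker : ∀ᵐ r ∂(volume.restrict (Ioo 0 T)), ∀ j,
      mlKer (multiExp α a) (multiCoef b (lam j)) α r ≤
      mlKer (multiExp α a) (multiCoef b 0) α r :=
    ae_all_iff.2 fun j => ae_multiKer_le hα0 hα1 ha hb (hφ.eigenvalue_nonneg j) T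
  filter_upwards [self_mem_ae_restrict measurableSet_Ioo,
    ae_integrableOn_vconv (integrableOn_mlKer (w := multiCoef b 0) hβ hα0 T) hF] with t ht hconv
  have hle : volume.restrict (Ioo 0 t) ≤ volume.restrict (Ioo 0 T) :=
    Measure.restrict_mono (Ioo_subset_Ioo_right ht.2.le) le_rfl
  have hmain : ∀ᵐ s ∂(volume.restrict (Ioo 0 t)),
      0 ≤ mlKer (multiExp α a) (multiCoef b 0) α (t - s) ∧
      (Summable fun j => f s (φ j) ^ 2 / (1 + lam j)) ∧
      ∀ j, |kernelE α a b (lam j) (t - s) * f s (φ j)| ≤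
        mlKer (multiExp α a) (multiCoef b 0) α (t - s) * |f s (φ j)| := by
    filter_upwards [self_mem_ae_restrict measurableSet_Ioo, ae_mono hle hfs,
      ae_comp_sub_left ht.2.le hker] with s hs h1 h2
    have hts : 0 < t - s := sub_pos.2 hs.2
    refine ⟨(multiKer_pos hα0 hα1 ha hb le_rfl hts).le, h1, fun j => ?_⟩
    have h3 := multiKer_pos hα0 hα1 ha hb (hφ.eigenvalue_nonneg j) hts
    rw [abs_mul, kernelE_eq_mlKer _ _ _ _ hts, abs_of_pos h3]
    exact mul_le_mul_of_nonneg_right (h2 j) (abs_nonneg _)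
  have hsum : ∀ᵐ s ∂(volume.restrict (Ioo 0 t)),
      Summable (fun j => (kernelE α a b (lam j) (t - s) * f s (φ j)) ^ 2 / (1 + lam j)) := by
    filter_upwards [hmain] with s hs
    exact (hφ.summable_of_abs_le hs.2.1 hs.2.2).1
  refine ⟨hsum, Integrable.mono hconv ?_ ?_⟩
  · refine aestronglyMeasurable_synth (φ := φ)
      (c := fun s j => kernelE α a b (lam j) (t - s) * f s (φ j)) (fun j => ?_)
      (hsum.mono fun s hs => hφ.summable_synth hs)
    refine AEStronglyMeasurable.mul ?_
      ((ContinuousLinearMap.apply ℝ ℝ (φ j)).continuous.comp_aestronglyMeasurable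
        (hf.mono_measure hle))
    refine ContinuousOn.aestronglyMeasurable (ContinuousOn.congr
      (f := fun s => mlKer (multiExp α a) (multiCoef b (lam j)) α (t - s)) ?_ ?_)
      measurableSet_Ioo
    · exact (continuousOn_mlKer hβ hα0).comp (by fun_prop) fun s hs => sub_pos.2 hs.2
    · exact fun s hs => kernelE_eq_mlKer _ _ _ _ (sub_pos.2 hs.2)
  · filter_upwards [hmain] with s hs
    rw [norm_smul, Real.norm_of_nonneg hs.1]
    exact hφ.norm_synth_le hs.1 hs.2.1 hs.2.2

/-- Evaluation at φ_j and `spanProj` are continuous linear maps, so they pass through the Bochner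
integral and act on the series. -/
theorem solRep_apply_and_spanProj (hφ : IsDirichletEigensystem Ω lam φ) {t : ℝ}
    {f : ℝ → Hneg1 Ω}
    (hs : ∀ᵐ s ∂(volume.restrict (Ioo 0 t)),
        Summable (fun j => (kernelE α a b (lam j) (t - s) * f s (φ j)) ^ 2 / (1 + lam j)))
    (hi : IntegrableOn (fun s => Ebar lam φ α a b (t - s) (f s)) (Ioo 0 t)) :
    (∀ j, solRep lam φ α a b f t (φ j) = solCoef lam φ α a b f j t) ∧
      spanProj (normEigen lam φ) (solRep lam φ α a b f t) = solRep lam φ α a b f t := by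
  constructor
  · intro j
    rw [solRep, ContinuousLinearMap.integral_apply hi, solCoef, vconv]
    refine integral_congr_ae ?_
    filter_upwards [self_mem_ae_restrict measurableSet_Ioo, hs] with s hs' h
    have := hφ.synth_apply h j
    rw [kernelE_eq_mlKer _ _ _ _ (sub_pos.2 hs'.2)] at this
    exact this
  · rw [solRep, ← ContinuousLinearMap.integral_comp_comm _ hi]
    refine integral_congr_ae ?_
    filter_upwards [hs] with s h
    exact hφ.spanProj_synth h

theorem vconv_synth_apply_and_spanProj (hφ : IsDirichletEigensystem Ω lam φ) {t T : ℝ}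
    (ht : t ≤ T) {k : ℝ → ℝ} {c : ℝ → ℕ → ℝ}
    (hc : ∀ᵐ s ∂(volume.restrict (Ioo 0 T)), Summable fun j => c s j ^ 2 / (1 + lam j))
    (hi : IntegrableOn (fun s => k (t - s) • synth φ (c s)) (Ioo 0 t)) :
    (∀ j, vconv k (fun s => synth φ (c s)) t (φ j) = vconv k (fun s => c s j) t) ∧
      spanProj (normEigen lam φ) (vconv k (fun s => synth φ (c s)) t) =
        vconv k (fun s => synth φ (c s)) t := by
  have hle : volume.restrict (Ioo 0 t) ≤ volume.restrict (Ioo 0 T) :=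
    Measure.restrict_mono (Ioo_subset_Ioo_right ht) le_rfl
  constructor
  · intro j
    rw [vconv, ContinuousLinearMap.integral_apply hi, vconv]
    refine integral_congr_ae ?_
    filter_upwards [ae_mono hle hc] with s h
    rw [smul_apply, hφ.synth_apply h j]
  · rw [vconv, ← ContinuousLinearMap.integral_comp_comm _ hi]
    refine integral_congr_ae ?_
    filter_upwards [ae_mono hle hc] with s h
    rw [map_smul, hφ.spanProj_synth h]

end Solution

end

end FracDiffusion

/-! ### Maximal L² regularity -/

theorem theorem2p3 {d m : ℕ} (hd : 1 ≤ d) (hd3 : d ≤ 3)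
    (Ω : Set (EuclideanSpace ℝ (Fin d))) (hΩ : IsConvexPolytopeDomain Ω)
    (lam : ℕ → ℝ) (φ : ℕ → H10 Ω) (hφ : IsDirichletEigensystem Ω lam φ)
    (α : ℝ) (a b : Fin m → ℝ) (hα0 : 0 < α) (hα1 : α < 1)
    (ha : ∀ i, 0 < a i ∧ a i < α) (hb : ∀ i, 0 < b i)
    (T : ℝ) (hT : 0 < T) (q : ℝ) (hq : -1 < q) (hq1 : q ≤ 1) :
    ∃ C : ℝ≥0, ∀ f : ℝ → Hneg1 Ω, MemL2DotH lam φ q T f →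
      -- the series and the integral in the representation converge
      (∀ᵐ t ∂(volume.restrict (Ioo 0 T)),
        (∀ᵐ s ∂(volume.restrict (Ioo 0 t)),
          Summable (EbarTerm lam φ α a b (t - s) (f s))) ∧
        IntegrableOn (fun s => Ebar lam φ α a b (t - s) (f s)) (Ioo 0 t)) ∧
      MemL2DotH lam φ (q + 2) T (solRep lam φ α a b f) ∧
      ∃ g : ℝ → Hneg1 Ω,
        HasMultiTermDeriv α a b T (solRep lam φ α a b f) g ∧
        MemL2DotH lam φ q T g ∧
        ∀ t ∈ Ioc 0 T,
          normL2DotH lam φ (q + 2) t (solRep lam φ α a b f) + normL2DotH lam φ q t g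
            ≤ C * normL2DotH lam φ q t f := by
  obtain ⟨c₀, hc₀, hlam⟩ := hφ.exists_le_eigenvalue hd hΩ.isBounded
  have hpos : ∀ j, 0 < lam j := fun j => hc₀.trans_le (hlam j)
  -- 3 = 1 + 2: the bound for u has constant 1, the bound for P(∂ₜ)u has constant 2.
  refine ⟨3, fun f ⟨hfm, hfn⟩ => ?_⟩
  have hmono : ∀ {t}, t ∈ Ioc 0 T → volume.restrict (Ioo 0 t) ≤ volume.restrict (Ioo 0 T) :=
    fun ht => Measure.restrict_mono (Ioo_subset_Ioo_right ht.2) le_rfl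
  have hfj : ∀ j, AEStronglyMeasurable (fun t => f t (φ j)) (volume.restrict (Ioo 0 T)) :=
    fun j => (ContinuousLinearMap.apply ℝ ℝ (φ j)).continuous.comp_aestronglyMeasurable hfm
  have hffin : ∫⁻ t in Ioo 0 T, ∑' j, ENNReal.ofReal (lam j ^ q * f t (φ j) ^ 2) < ⊤ := by
    have := (ENNReal.rpow_lt_top_iff_of_pos (show (0 : ℝ) < 1 / 2 by norm_num)).1 hfn
    exact this
  obtain ⟨hfs, hF⟩ := hφ.ae_summable_and_integrableOn_synth hc₀ hlam hq hfj hffin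
  have hfji : ∀ j, IntegrableOn (fun t => f t (φ j)) (Ioo 0 T) := by
    intro j
    -- The coefficients are read off the synthesized series, whose H⁻¹ norm the Ḣ^q norm of f
    -- controls directly.
    refine ((ContinuousLinearMap.apply ℝ ℝ (φ j)).integrable_comp hF).congr ?_
    filter_upwards [hfs] with t ht
    exact hφ.synth_apply ht j
  -- the coefficients of the solution
  have hym : ∀ j, IntegrableOn (solCoef lam φ α a b f j) (Ioo 0 T) := fun j =>
    integrableOn_vconv (integrableOn_mlKer (multiExp_pos hα0 ha) hα0 T) (hfji j)
  have hy : ∀ t ∈ Ioc 0 T, ∫⁻ τ in Ioo 0 t,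
      ∑' j, ENNReal.ofReal (lam j ^ q * (lam j * solCoef lam φ α a b f j τ) ^ 2) ≤
      ∫⁻ τ in Ioo 0 t, ∑' j, ENNReal.ofReal (lam j ^ q * f τ (φ j) ^ 2) := fun t ht =>
    lintegral_tsum_weighted_le hφ q
      (c := fun j τ => lam j * solCoef lam φ α a b f j τ) (e := fun j τ => f τ (φ j))
      (fun j => ((hym j).1.mono_measure (hmono ht)).aemeasurable.const_mul _)
      (fun j => ((hfj j).mono_measure (hmono ht)).aemeasurable)
      fun j => lintegral_solCoef_le hφ hα0 hα1 ha hb ht.1 (hfm.mono_measure (hmono ht)) j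
  -- the coefficients of the derivative
  let Gc : ℝ → ℕ → ℝ := fun t j => f t (φ j) - lam j • solCoef lam φ α a b f j t
  have hGm : ∀ j, AEStronglyMeasurable (fun t => Gc t j) (volume.restrict (Ioo 0 T)) := fun j =>
    (hfj j).sub ((hym j).1.const_smul (lam j))
  -- The 4 comes from (x − y)² ≤ 2x² + 2y² and the bound on λ_j u_j; its square root is the constant
  -- 2 for P(∂ₜ)u.
  have hGle : ∀ t ∈ Ioc 0 T, ∫⁻ τ in Ioo 0 t,
      ∑' j, ENNReal.ofReal (lam j ^ q * Gc τ j ^ 2) ≤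
      4 * ∫⁻ τ in Ioo 0 t, ∑' j, ENNReal.ofReal (lam j ^ q * f τ (φ j) ^ 2) := by
    intro t ht
    have hm1 : AEMeasurable (fun τ => ∑' j, ENNReal.ofReal (lam j ^ q * f τ (φ j) ^ 2))
        (volume.restrict (Ioo 0 t)) := AEMeasurable.tsum fun j =>
      (((hfj j).mono_measure (hmono ht)).aemeasurable.pow_const 2 |>.const_mul _).ennreal_ofReal
    calc _ ≤ ∫⁻ τ in Ioo 0 t, (2 * ∑' j, ENNReal.ofReal (lam j ^ q * f τ (φ j) ^ 2) + 2 *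
          ∑' j, ENNReal.ofReal (lam j ^ q * (lam j * solCoef lam φ α a b f j τ) ^ 2)) := by
          refine lintegral_mono fun τ => ?_
          rw [← ENNReal.tsum_mul_left, ← ENNReal.tsum_mul_left, ← ENNReal.tsum_add]
          refine ENNReal.tsum_le_tsum fun j => ?_
          have hl := Real.rpow_nonneg (hpos j).le q
          have e2 : (2 : ℝ≥0∞) = ENNReal.ofReal 2 := by simp
          rw [e2, ← ENNReal.ofReal_mul zero_le_two, ← ENNReal.ofReal_mul zero_le_two,
            ← ENNReal.ofReal_add (by positivity) (by positivity)]
          refine ENNReal.ofReal_le_ofReal ?_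
          have h1 : Gc τ j ^ 2 ≤ 2 * f τ (φ j) ^ 2 +
              2 * (lam j * solCoef lam φ α a b f j τ) ^ 2 := by
            simp only [Gc, smul_eq_mul]
            nlinarith [sq_nonneg (f τ (φ j) + lam j * solCoef lam φ α a b f j τ)]
          nlinarith [mul_le_mul_of_nonneg_left h1 hl]
      _ = 2 * (∫⁻ τ in Ioo 0 t, ∑' j, ENNReal.ofReal (lam j ^ q * f τ (φ j) ^ 2)) + 2 *
          ∫⁻ τ in Ioo 0 t,
            ∑' j, ENNReal.ofReal (lam j ^ q * (lam j * solCoef lam φ α a b f j τ) ^ 2) := by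
          rw [lintegral_add_left' (hm1.const_mul _), lintegral_const_mul'' _ hm1,
            lintegral_const_mul' _ _ (by norm_num)]
      _ ≤ 2 * (∫⁻ τ in Ioo 0 t, ∑' j, ENNReal.ofReal (lam j ^ q * f τ (φ j) ^ 2)) + 2 *
          ∫⁻ τ in Ioo 0 t, ∑' j, ENNReal.ofReal (lam j ^ q * f τ (φ j) ^ 2) := by
          exact add_le_add le_rfl (mul_le_mul' le_rfl (hy t ht))
      _ = _ := by rw [← add_mul]; norm_num
  have hTT : T ∈ Ioc 0 T := ⟨hT, le_rfl⟩
  have hGfin : ∫⁻ τ in Ioo 0 T, ∑' j, ENNReal.ofReal (lam j ^ q * Gc τ j ^ 2) < ⊤ :=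
    (hGle T hTT).trans_lt (ENNReal.mul_lt_top (by norm_num) hffin)
  obtain ⟨hGs, hG⟩ := hφ.ae_summable_and_integrableOn_synth hc₀ hlam hq hGm hGfin
  -- convergence of the representation
  have hE := ae_Ebar_convergence hφ hα0 hα1 ha hb hfm hfs hF
  have hsol : ∀ᵐ t ∂(volume.restrict (Ioo 0 T)),
      (∀ j, solRep lam φ α a b f t (φ j) = solCoef lam φ α a b f j t) ∧
      spanProj (normEigen lam φ) (solRep lam φ α a b f t) = solRep lam φ α a b f t :=
    hE.mono fun t ht => solRep_apply_and_spanProj hφ ht.1 ht.2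
  -- Both sides are fixed by `spanProj`, so the scalar identity `ae_vconv_multiKer_eq` for each mode
  -- is enough.
  have hu : solRep lam φ α a b f =ᵐ[volume.restrict (Ioo 0 T)]
      vconv (mlKer (multiExp α a) (multiCoef b 0) α) fun s => synth φ (Gc s) := by
    filter_upwards [self_mem_ae_restrict measurableSet_Ioo, hsol,
      ae_integrableOn_vconv (integrableOn_mlKer (w := multiCoef b 0) (multiExp_pos hα0 ha) hα0 T) hG,
      ae_all_iff.2 fun j => ae_vconv_multiKer_eq (b := b) hα0 ha (lam j) (hfji j)]
      with t ht h1 h2 h3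
    obtain ⟨h4, h5⟩ := vconv_synth_apply_and_spanProj hφ ht.2.le hGs h2
    refine eq_of_spanProj_normEigen h1.2 h5 fun j => ?_
    rw [h1.1 j, h4 j]
    exact (h3 j).symm
  have hui : IntegrableOn (solRep lam φ α a b f) (Ioo 0 T) :=
    (integrableOn_vconv (integrableOn_mlKer (multiExp_pos hα0 ha) hα0 T) hG).congr hu.symm
  -- the norms
  have hnu : ∀ t ∈ Ioc 0 T,
      normL2DotH lam φ (q + 2) t (solRep lam φ α a b f) ≤ normL2DotH lam φ q t f := by
    intro t ht
    refine ENNReal.rpow_le_rpow (le_trans (le_of_eq (lintegral_congr_ae ?_)) (hy t ht))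
      (by norm_num)
    filter_upwards [ae_mono (hmono ht) hsol] with τ hτ
    refine tsum_congr fun j => ?_
    rw [hτ.1 j, Real.rpow_add (hpos j), Real.rpow_two, mul_pow]
    ring_nf
  have hng : ∀ t ∈ Ioc 0 T,
      normL2DotH lam φ q t (fun s => synth φ (Gc s)) ≤ 2 * normL2DotH lam φ q t f := by
    intro t ht
    have h1 : ∫⁻ τ in Ioo 0 t, dotHSq lam φ q (synth φ (Gc τ)) ≤
        4 * ∫⁻ τ in Ioo 0 t, dotHSq lam φ q (f τ) := by
      refine le_trans (le_of_eq (lintegral_congr_ae ?_)) (hGle t ht)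
      filter_upwards [ae_mono (hmono ht) hGs] with τ hτ
      refine tsum_congr fun j => ?_
      rw [hφ.synth_apply hτ j]
    refine (ENNReal.rpow_le_rpow h1 (by norm_num : (0 : ℝ) ≤ 1 / 2)).trans (le_of_eq ?_)
    rw [ENNReal.mul_rpow_of_nonneg _ _ (by norm_num), show (4 : ℝ≥0∞) = 2 ^ (2 : ℝ) by norm_num,
      ← ENNReal.rpow_mul]
    norm_num [normL2DotH]
  refine ⟨?_, ⟨hui.1, (hnu T hTT).trans_lt hfn⟩, fun s => synth φ (Gc s),
    hasMultiTermDeriv_vconv hα0 hα1 ha hG hu,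
    ⟨hG.1, (hng T hTT).trans_lt (ENNReal.mul_lt_top (by norm_num) hfn)⟩, fun t ht => ?_⟩
  · filter_upwards [hE] with t ht
    exact ⟨ht.1.mono fun s hs => hφ.summable_synth hs, ht.2⟩
  · calc _ ≤ normL2DotH lam φ q t f + 2 * normL2DotH lam φ q t f :=
          add_le_add (hnu t ht) (hng t ht)
      _ = _ := by
        rw [← one_add_mul]
        norm_num
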